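/- Let $K$ be a field of characteristic zero, let $A_n$ be the $n$-th Weyl algebra over $K$ (generators $q_1,\dots,q_n,p_1,\dots,p_n$, relations $[p_i,q_j]=\delta_{ij}$, $[p_i,p_j]=[q_i,q_j]=0$), let $P_m=K[x_{2n+1},\dots,x_{2n+m}]$ be a polynomial algebra, and put $A:=A_n\otimes_K P_m$, $s:=2n+m$, $x_i:=q_i$, $x_{n+i}:=p_i$ for $1\le i\le n$. Write $\partial/\partial x_{2n+l}$ for the derivation $\mathrm{id}\otimes\partial/\partial x_{2n+l}$ of $A$, $[a,b]:=ab-ba$, and $N(f,A):=\{a\in A : f^k(a)=0\text{ for some }k\ge 0\}$ for a map $f:A\to A$. Let $\sigma$ be a $K$-algebra endomorphism of $A$ such that $\Delta:=\det\left(\partial\sigma(x_{2n+i})/\partial x_{2n+j}\right)_{1\le i,j\le m}\in K^*$. Put $x'_i:=\sigma(x_i)$ for $1\le i\le s$ and define maps $\partial'_1,\dots,\partial'_s:A\to A$ by $$\partial'_i(a):=[x'_{n+i},a],\qquad \partial'_{n+i}(a):=-[x'_i,a]\qquad(1\le i\le n),$$ and, for $1\le j\le m$, let $\partial'_{2n+j}(a)$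 be $\Delta^{-1}$ times the determinant of the matrix obtained from $\left(\partial x'_{2n+k}/\partial x_{2n+l}\right)_{k,l}$ by replacing its $j$-th row by $(\partial a/\partial x_{2n+1},\dots,\partial a/\partial x_{2n+m})$. (Determinants are given by the Leibniz formula, the factors of each summand being taken in the order of the rows.) Let $B$ be the subalgebra of $A$ generated by $\sigma(A)$ and $P_m$. Then the following hold. 1. $\bigcap_{i=1}^s\{a\in A:\partial'_i(a)=0\}=K$. Moreover, $\bigcap_{i=1}^s N(\partial'_i,A)=\sigma(A)$ if and only if $x'_i\in N(\partial'_{2n+j},A)$ for all $1\le i\le 2n$ and $1\le j\le m$ (in particular, this equality holds whenever $\partial'_{2n+j}(x'_i)=0$ for all such $i,j$). 2. $\bigcap_{i=1}^{2n}N(\partial'_i,A)=B$, and there are $K$-derivations $\delta_1,\dots,\delta_m$ of $B$ with $\delta_j(x'_i)=1$ if $i=2n+j$ and $\delta_j(x'_i)=0$ otherwise $(1\le i\le s)$. 3. Let $D$ be any subalgebra with $B\subseteq D\subseteq A$ (for instance $D=B$ or $D=A$), and let $\delta_1,\dots,\delta_m$ be any $K$-derivations of $D$ with $\delta_j(x'_i)=1$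 if $i=2n+j$ and $\delta_j(x'_i)=0$ otherwise $(1\le i\le s)$. Then $\delta_j$ coincides with $\partial'_{2n+j}$ on $P_m$ for each $j$, and $$\Bigl\{a\in D : a\in N(\partial'_i,A)\ (1\le i\le 2n),\ a\in N(\delta_j,D)\ (1\le j\le m)\Bigr\}=\sigma(A),$$ $$\Bigl\{a\in D : \partial'_i(a)=0\ (1\le i\le 2n),\ \delta_j(a)=0\ (1\le j\le m)\Bigr\}=K.$$ -/

import Mathlib

open scoped TensorProduct

noncomputable section

namespace WeylPoly

/-- The defining relations of the `n`-th Weyl algebra in the free algebra on the letters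
`q_i = Sum.inl i` and `p_i = Sum.inr i`:
`[p_i, q_j] = δ_ij`, `[p_i, p_j] = 0`, `[q_i, q_j] = 0`. -/
inductive WeylRel (K : Type*) [Field K] (n : ℕ) :
    FreeAlgebra K (Fin n ⊕ Fin n) → FreeAlgebra K (Fin n ⊕ Fin n) → Prop
  | pq (i j : Fin n) : WeylRel K n
      (FreeAlgebra.ι K (Sum.inr i) * FreeAlgebra.ι K (Sum.inl j))
      (FreeAlgebra.ι K (Sum.inl j) * FreeAlgebra.ι K (Sum.inr i) + if i = j then 1 else 0)
  | pp (i j : Fin n) : WeylRel K n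
      (FreeAlgebra.ι K (Sum.inr i) * FreeAlgebra.ι K (Sum.inr j))
      (FreeAlgebra.ι K (Sum.inr j) * FreeAlgebra.ι K (Sum.inr i))
  | qq (i j : Fin n) : WeylRel K n
      (FreeAlgebra.ι K (Sum.inl i) * FreeAlgebra.ι K (Sum.inl j))
      (FreeAlgebra.ι K (Sum.inl j) * FreeAlgebra.ι K (Sum.inl i))

/-- The `n`-th Weyl algebra `A_n` over `K`. -/
abbrev Weyl (K : Type*) [Field K] (n : ℕ) : Type _ := RingQuot (WeylRel K n)

/-- The algebra `A_n ⊗ P_m`. -/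
abbrev Alg (K : Type*) [Field K] (n m : ℕ) : Type _ := Weyl K n ⊗[K] MvPolynomial (Fin m) K

/-- Labels of the canonical generators `x_1, …, x_s`, `s = 2n + m`:
`Sum.inl (Sum.inl i)` is `x_i = q_i`, `Sum.inl (Sum.inr i)` is `x_{n+i} = p_i` and
`Sum.inr j` is the central variable `x_{2n+j}`. -/
abbrev Gen (n m : ℕ) : Type := (Fin n ⊕ Fin n) ⊕ Fin m

variable {K : Type*} [Field K] {n m : ℕ}

/-- The canonical generators of `A_n ⊗ P_m`. -/
def gen : Gen n m → Alg K n m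
  | Sum.inl a => RingQuot.mkAlgHom K (WeylRel K n) (FreeAlgebra.ι K a) ⊗ₜ[K] 1
  | Sum.inr j => 1 ⊗ₜ[K] MvPolynomial.X j

/-- The partial derivative `∂ / ∂ x_{2n+l}` of `A_n ⊗ P_m`, that is `id ⊗ ∂ / ∂ x_{2n+l}`. -/
def centralPartial (l : Fin m) : Alg K n m →ₗ[K] Alg K n m :=
  LinearMap.lTensor (Weyl K n) (MvPolynomial.pderiv (R := K) l).toLinearMap

/-- The subalgebra `P_m = 1 ⊗ P_m` of `A_n ⊗ P_m`. -/
def polyPart (K : Type*) [Field K] (n m : ℕ) : Subalgebra K (Alg K n m) :=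
  (Algebra.TensorProduct.includeRight :
    MvPolynomial (Fin m) K →ₐ[K] Alg K n m).range

/-- The determinant by the Leibniz formula, for entries in a ring that is not assumed to be
commutative; in each summand the factors are multiplied in the order of the rows. When the entries
commute this is the usual determinant. -/
def leibnizDet {R : Type*} [Ring R] (M : Matrix (Fin m) (Fin m) R) : R :=
  ∑ π : Equiv.Perm (Fin m), (Equiv.Perm.sign π : ℤ) • (List.ofFn fun i => M i (π i)).prod

/-- The Jacobian matrix `(∂ σ(x_{2n+i}) / ∂ x_{2n+j})` of `σ` on the central variables. -/
def jac (σ : Alg K n m →ₐ[K] Alg K n m) : Matrix (Fin m) (Fin m) (Alg K n m) :=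
  Matrix.of fun i j => centralPartial j (σ (gen (Sum.inr i)))

/-- The maps `∂'_1, …, ∂'_s` attached to `σ`; here `Δ` is the Jacobian determinant of `σ`.
`∂'_i = ad σ(x_{n+i})` and `∂'_{n+i} = - ad σ(x_i)` for `i = 1, …, n`, and `∂'_{2n+j}(a)` is
`Δ⁻¹` times the determinant of the Jacobian matrix with its `j`-th row replaced by
`(∂a / ∂x_{2n+1}, …, ∂a / ∂x_{2n+m})`. -/
def partial' (σ : Alg K n m →ₐ[K] Alg K n m) (Δ : K) : Gen n m → Alg K n m → Alg K n m
  | Sum.inl (Sum.inl i), a =>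
      σ (gen (Sum.inl (Sum.inr i))) * a - a * σ (gen (Sum.inl (Sum.inr i)))
  | Sum.inl (Sum.inr i), a =>
      -(σ (gen (Sum.inl (Sum.inl i))) * a - a * σ (gen (Sum.inl (Sum.inl i))))
  | Sum.inr j, a => Δ⁻¹ • leibnizDet ((jac σ).updateRow j fun l => centralPartial l a)

/-- `N(f, X) = {a ∈ X | f^k(a) = 0 for some k}`. -/
def nilPart {X : Type*} [Zero X] (f : X → X) : Set X := {a | ∃ k : ℕ, f^[k] a = 0}

/-- The subalgebra of `A_n ⊗ P_m` generated by `σ(A_n ⊗ P_m)` and `P_m`. -/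
def imagePoly (σ : Alg K n m →ₐ[K] Alg K n m) : Subalgebra K (Alg K n m) :=
  σ.range ⊔ polyPart K n m

/-- `δ_1, …, δ_m` are `K`-derivations of the subalgebra `D` and, with `x'_g = σ(x_g)`, each `δ_j`
sends `x'_{2n+j}` to `1` and all the other `x'_g` to `0`. -/
def IsCentralPartials (σ : Alg K n m →ₐ[K] Alg K n m) (D : Subalgebra K (Alg K n m))
    (δ : Fin m → D →ₗ[K] D) : Prop :=
  (∀ j, ∀ a b : D, δ j (a * b) = δ j a * b + a * δ j b) ∧
  ∀ j, ∀ g : Gen n m, ∀ h : σ (gen g) ∈ D,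
    δ j ⟨σ (gen g), h⟩ = if g = Sum.inr j then 1 else 0

end WeylPoly

end

/-! The crux is `IsModel.mem_range_of_commute`: an element $c$ commuting with any family `u` that
satisfies the Weyl relations lies in $P_m$. The algebra is filtered by word length in the
generators, and the $N$-th layer has dimension at most $(N+1)^s$, because $s$ commuting derivations
act on it nilpotently with common kernel $K$. If $c$ were outside $P_m$, the products of powers of
the `u b`, of $c$ and of the central variables with exponents below $N$ would be $N^{s+1}$
independent elements in a layer of index $O(N)$, which is impossible for large $N$.

For `u` $=(\sigma(q),\sigma(p))$ this has two consequences. The images $f_k=\sigma(x_{2n+k})$ lie in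
$P_m$, so the Leibniz determinants are ordinary ones up to one row, and $\partial'_{2n+j}$ is a
derivation `jacDer` dual to the $f_k$. Moreover the constants of the inner derivations $\partial'_i$
form $P_m$, so Taylor expansion (`mem_of_nilpotent`) identifies their common nil part with $B$. On
$P_m$ a second expansion, in the $f_k$, has only scalar constants.

In general $\partial'_{2n+j}$ does not kill $\sigma(q),\sigma(p)$. The true partial derivatives on
$B$ come from the endomorphism $\tau$ that equals $\sigma$ on $A_n$ and the identity on $P_m$: it is
an isomorphism of $A$ onto $B$ and carries `jacDer` to $\delta_j$. For $B\subseteq D$, any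
$\delta_j$ on $D$ is forced on $P_m$ by the Jacobian and hence on $B$ by $\tau$. The conditions
involving $\sigma(q),\sigma(p)$ already confine the elements in question to $B$, or to $P_m$ for
kernels. -/

noncomputable section

namespace WeylPoly

/-! ### Derivations, nilpotency degrees and Taylor expansion. -/

section Derivations

variable {K R : Type*} [Field K] [Ring R] [Algebra K R]

/-- `D` satisfies the Leibniz rule. -/
def IsDer (D : R →ₗ[K] R) : Prop := ∀ a b, D (a * b) = D a * b + a * D b

theorem IsDer.map_one {D : R →ₗ[K] R} (hD : IsDer D) : D 1 = 0 := by
  simpa using hD 1 1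

theorem IsDer.map_algebraMap {D : R →ₗ[K] R} (hD : IsDer D) (r : K) :
    D (algebraMap K R r) = 0 := by
  rw [Algebra.algebraMap_eq_smul_one, map_smul, hD.map_one, smul_zero]

theorem IsDer.neg {D : R →ₗ[K] R} (hD : IsDer D) : IsDer (-D) := by
  intro a b
  simp only [LinearMap.neg_apply, hD a b]
  noncomm_ring

theorem IsDer.commutator {D E : R →ₗ[K] R} (hD : IsDer D) (hE : IsDer E) :
    IsDer (D ∘ₗ E - E ∘ₗ D) := by
  intro a b
  simp only [LinearMap.sub_apply, LinearMap.comp_apply, hD a b, hE a b, map_add, hD _ _, hE _ _]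
  noncomm_ring

/-- A derivation that kills generators is zero. -/
theorem IsDer.eq_zero_of_adjoin {D : R →ₗ[K] R} (hD : IsDer D) {s : Set R}
    (hs : Algebra.adjoin K s = ⊤) (h : ∀ a ∈ s, D a = 0) (a : R) : D a = 0 := by
  have ha : a ∈ Algebra.adjoin K s := hs ▸ trivial
  induction ha using Algebra.adjoin_induction with
  | mem x hx => exact h x hx
  | algebraMap r => exact hD.map_algebraMap r
  | add x y _ _ hx hy => rw [map_add, hx, hy, add_zero]
  | mul x y _ _ hx hy => rw [hD, hx, hy, zero_mul, mul_zero, add_zero]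

theorem pow_succ_apply' (D : R →ₗ[K] R) (k : ℕ) (a : R) : (D ^ (k + 1)) a = (D ^ k) (D a) := by
  rw [pow_succ, Module.End.mul_apply]

theorem pow_succ_apply (D : R →ₗ[K] R) (k : ℕ) (a : R) : (D ^ (k + 1)) a = D ((D ^ k) a) := by
  rw [pow_succ', Module.End.mul_apply]

theorem pow_apply_eq_zero_of_le {D : R →ₗ[K] R} {k l : ℕ} (h : k ≤ l) {a : R}
    (ha : (D ^ k) a = 0) : (D ^ l) a = 0 := by
  obtain ⟨t, rfl⟩ := Nat.exists_eq_add_of_le' h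
  rw [pow_add, Module.End.mul_apply, ha, map_zero]

theorem IsDer.pow_mul {D : R →ₗ[K] R} (hD : IsDer D) (N : ℕ) (a b : R) :
    (D ^ N) (a * b) =
      ∑ ij ∈ Finset.HasAntidiagonal.antidiagonal N, N.choose ij.1 • ((D ^ ij.1) a * (D ^ ij.2) b) := by
  induction N with
  | zero => simp
  | succ N ih =>
    rw [Finset.sum_antidiagonal_choose_succ_nsmul (fun i j => (D ^ i) a * (D ^ j) b) N,
      pow_succ_apply, ih, map_sum, ← Finset.sum_add_distrib]
    refine Finset.sum_congr rfl fun ij hij => ?_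
    rw [map_nsmul, hD, ← pow_succ_apply, ← pow_succ_apply, nsmul_add, add_comm,
      Nat.choose_symm_of_eq_add (Finset.HasAntidiagonal.mem_antidiagonal.1 hij).symm]

/-- In the Leibniz expansion every index pair other than $(d,e)$ exceeds $d$ on the left or $e$ on
the right. -/
theorem IsDer.pow_mul_top {D : R →ₗ[K] R} (hD : IsDer D) {d e : ℕ} {a b : R}
    (ha : (D ^ (d + 1)) a = 0) (hb : (D ^ (e + 1)) b = 0) :
    (D ^ (d + e)) (a * b) = (d + e).choose d • ((D ^ d) a * (D ^ e) b) := by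
  rw [hD.pow_mul, Finset.sum_eq_single (d, e)]
  · rintro ⟨i, j⟩ hij hne
    rw [Finset.HasAntidiagonal.mem_antidiagonal] at hij
    simp only at hij
    rcases lt_trichotomy i d with h | h | h
    · rw [pow_apply_eq_zero_of_le (by lia : e + 1 ≤ j) hb, mul_zero, smul_zero]
    · exact absurd (by rw [Prod.mk.injEq]; lia) hne
    · rw [pow_apply_eq_zero_of_le (by lia : d + 1 ≤ i) ha, zero_mul, smul_zero]
  · intro h
    simp at h

theorem IsDer.pow_mul_eq_zero {D : R →ₗ[K] R} (hD : IsDer D) {d e N : ℕ} {a b : R}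
    (ha : (D ^ d) a = 0) (hb : (D ^ e) b = 0) (hN : d + e ≤ N + 1) : (D ^ N) (a * b) = 0 := by
  rw [hD.pow_mul]
  refine Finset.sum_eq_zero ?_
  rintro ⟨i, j⟩ hij
  rw [Finset.HasAntidiagonal.mem_antidiagonal] at hij
  simp only at hij
  rcases le_or_gt d i with h | h
  · rw [pow_apply_eq_zero_of_le h ha, zero_mul, smul_zero]
  · rw [pow_apply_eq_zero_of_le (by lia : e ≤ j) hb, mul_zero, smul_zero]

theorem IsDer.pow_mul_of_ker_left {D : R →ₗ[K] R} (hD : IsDer D) {a : R} (ha : D a = 0) (b : R)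
    (k : ℕ) : (D ^ k) (a * b) = a * (D ^ k) b := by
  induction k with
  | zero => rfl
  | succ k ih => rw [pow_succ_apply, ih, hD, ha, zero_mul, zero_add, ← pow_succ_apply]

theorem IsDer.pow_mul_of_ker_right {D : R →ₗ[K] R} (hD : IsDer D) (a : R) {b : R} (hb : D b = 0)
    (k : ℕ) : (D ^ k) (a * b) = (D ^ k) a * b := by
  induction k with
  | zero => rfl
  | succ k ih => rw [pow_succ_apply, ih, hD, hb, mul_zero, add_zero, ← pow_succ_apply]

theorem IsDer.map_pow_eq_zero {D : R →ₗ[K] R} (hD : IsDer D) {a : R} (ha : D a = 0) (k : ℕ) :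
    D (a ^ k) = 0 := by
  induction k with
  | zero => rw [pow_zero, hD.map_one]
  | succ k ih => rw [pow_succ, hD, ha, ih, zero_mul, mul_zero, add_zero]

theorem IsDer.map_pow_slice {D : R →ₗ[K] R} (hD : IsDer D) {x : R} (hx : D x = 1) (k : ℕ) :
    D (x ^ (k + 1)) = (k + 1 : ℕ) • x ^ k := by
  induction k with
  | zero => simp [hx]
  | succ k ih =>
    rw [pow_succ, hD, ih, hx, mul_one, smul_mul_assoc, ← pow_succ, ← succ_nsmul]

theorem IsDer.pow_pow_slice {D : R →ₗ[K] R} (hD : IsDer D) {x : R} (hx : D x = 1) (k : ℕ) :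
    (D ^ k) (x ^ k) = (k.factorial : ℕ) • (1 : R) := by
  induction k with
  | zero => simp
  | succ k ih =>
    rw [pow_succ_apply', hD.map_pow_slice hx, map_nsmul, ih, smul_smul, Nat.factorial_succ]

/-- The subalgebra of elements on which a derivation is nilpotent. -/
def nilSubalgebra (D : R →ₗ[K] R) (hD : IsDer D) : Subalgebra K R where
  carrier := {a | ∃ k : ℕ, (D ^ k) a = 0}
  mul_mem' := by
    rintro a b ⟨k, hk⟩ ⟨l, hl⟩
    exact ⟨k + l, hD.pow_mul_eq_zero hk hl (by lia)⟩
  add_mem' := by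
    rintro a b ⟨k, hk⟩ ⟨l, hl⟩
    exact ⟨k + l, by rw [map_add, pow_apply_eq_zero_of_le (by lia) hk,
      pow_apply_eq_zero_of_le (by lia) hl, add_zero]⟩
  algebraMap_mem' r := ⟨1, by rw [pow_one, hD.map_algebraMap]⟩

theorem mem_nilPart_iff {D : R →ₗ[K] R} {a : R} : a ∈ nilPart D ↔ ∃ k : ℕ, (D ^ k) a = 0 := by
  simp only [nilPart, Set.mem_ofPred_eq, Module.End.pow_apply]

/-- The inner derivation `[u, ·]`. -/
def ad (K : Type*) {R : Type*} [Field K] [Ring R] [Algebra K R] (u : R) : R →ₗ[K] R :=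
  LinearMap.mulLeft K u - LinearMap.mulRight K u

theorem ad_apply (u a : R) : ad K u a = u * a - a * u := rfl

theorem isDer_ad (u : R) : IsDer (ad K u) := by
  intro a b
  simp only [ad_apply]
  noncomm_ring

/-- `D` has nilpotency degree exactly `d` at `a`. -/
def HasNilDegree (D : R →ₗ[K] R) (a : R) (d : ℕ) : Prop := (D ^ d) a ≠ 0 ∧ (D ^ (d + 1)) a = 0

theorem exists_hasNilDegree {D : R →ₗ[K] R} {a : R} (ha : a ≠ 0) (h : ∃ k, (D ^ k) a = 0) :
    ∃ d, HasNilDegree D a d := by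
  classical
  have hpos : Nat.find h ≠ 0 := fun h0 => ha (by simpa [h0] using Nat.find_spec h)
  obtain ⟨d, hd⟩ := Nat.exists_eq_succ_of_ne_zero hpos
  exact ⟨d, Nat.find_min h (by lia), by simpa [hd] using Nat.find_spec h⟩

/-- Commuting derivations that are nilpotent at each element: a nonempty family of nonzero
elements closed under passing to the last nonvanishing derivative meets the common kernel. -/
theorem exists_mem_ker_of_hasNilDegree {ι : Type*} [Finite ι] {D : ι → R →ₗ[K] R}
    (hcomm : ∀ i j a, D i (D j a) = D j (D i a)) (hnil : ∀ i a, ∃ k, (D i ^ k) a = 0)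
    {Q : R → Prop} (hQ : ∀ i a d, Q a → HasNilDegree (D i) a d → Q ((D i ^ d) a))
    {a : R} (ha : Q a) (ha0 : a ≠ 0) : ∃ b, Q b ∧ b ≠ 0 ∧ ∀ i, D i b = 0 := by
  classical
  have := Fintype.ofFinite ι
  suffices h : ∀ s : Finset ι, ∃ b, Q b ∧ b ≠ 0 ∧ ∀ i ∈ s, D i b = 0 by
    obtain ⟨b, h1, h2, h3⟩ := h Finset.univ
    exact ⟨b, h1, h2, fun i => h3 i (Finset.mem_univ i)⟩
  intro s
  induction s using Finset.induction_on with
  | empty => exact ⟨a, ha, ha0, by simp⟩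
  | insert i s _ ih =>
    obtain ⟨b, h1, h2, h3⟩ := ih
    obtain ⟨d, hd⟩ := exists_hasNilDegree h2 (hnil i b)
    refine ⟨(D i ^ d) b, hQ i b d h1 hd, hd.1, fun j hj => ?_⟩
    rcases Finset.mem_insert.1 hj with rfl | hj
    · rw [← pow_succ_apply]; exact hd.2
    · have hc : Commute (D j) (D i) := LinearMap.ext fun a => hcomm j i a
      have := congrArg (fun f : Module.End K R => f b) (hc.pow_right d).eq
      simp only [Module.End.mul_apply] at this
      rw [this, h3 j hj, map_zero]

variable [CharZero K]

include K in
theorem nsmul_eq_zero_iff_of_algebra {c : ℕ} (hc : c ≠ 0) {a : R} : c • a = 0 ↔ a = 0 := by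
  rw [← Nat.cast_smul_eq_nsmul K, smul_eq_zero]
  simp [hc]

/-- Degrees add as for polynomials: the surviving binomial coefficient is nonzero in characteristic
zero and the leading derivatives multiply to a nonzero element. -/
theorem HasNilDegree.mul [NoZeroDivisors R] {D : R →ₗ[K] R} (hD : IsDer D) {a b : R} {d e : ℕ}
    (ha : HasNilDegree D a d) (hb : HasNilDegree D b e) : HasNilDegree D (a * b) (d + e) := by
  refine ⟨?_, hD.pow_mul_eq_zero ha.2 hb.2 (by lia)⟩
  rw [hD.pow_mul_top ha.2 hb.2, Ne,
    nsmul_eq_zero_iff_of_algebra (K := K) (Nat.choose_pos (by lia)).ne']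
  exact mul_ne_zero ha.1 hb.1

theorem HasNilDegree.pow [Nontrivial R] [NoZeroDivisors R] {D : R →ₗ[K] R} (hD : IsDer D) {a : R}
    {d : ℕ} (ha : HasNilDegree D a d) (k : ℕ) : HasNilDegree D (a ^ k) (k * d) := by
  induction k with
  | zero => simp [HasNilDegree, hD.map_one]
  | succ k ih => rw [pow_succ, Nat.succ_mul]; exact ih.mul hD ha

/-- Taylor expansion: elements on which commuting derivations with coordinates `x` are nilpotent
are polynomials in the coordinates with coefficients in the common kernel. -/
theorem mem_of_nilpotent {ι : Type*} [Fintype ι] [DecidableEq ι] {D : ι → R →ₗ[K] R}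
    (hD : ∀ i, IsDer (D i)) (hcomm : ∀ i j a, D i (D j a) = D j (D i a)) {x : ι → R}
    (hx : ∀ i j, D i (x j) = if i = j then 1 else 0) {T S : Subalgebra K R}
    (hTx : ∀ i, x i ∈ T) (hTD : ∀ i, ∀ a ∈ T, D i a ∈ T) (hSx : ∀ i, x i ∈ S)
    (hker : ∀ a ∈ T, (∀ i, D i a = 0) → a ∈ S) {a : R} (ha : a ∈ T)
    (hnil : ∀ i, ∃ k, (D i ^ k) a = 0) : a ∈ S := by
  have hcommpow (i j : ι) (k l : ℕ) (a : R) : (D i ^ k) ((D j ^ l) a) = (D j ^ l) ((D i ^ k) a) := by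
    have hc : Commute (D i) (D j) := LinearMap.ext fun a => hcomm i j a
    exact congrArg (fun f : Module.End K R => f a) (hc.pow_pow k l).eq
  have hTpow (i : ι) (k : ℕ) : ∀ a ∈ T, (D i ^ k) a ∈ T := by
    induction k with
    | zero => exact fun a h => h
    | succ k ih => exact fun a h => by rw [pow_succ_apply]; exact hTD i _ (ih a h)
  -- Induction on the sum of the nilpotency exponents; `T` rides along because `hker` is available
  -- only inside it.
  suffices h : ∀ N, ∀ k : ι → ℕ, ∑ i, k i = N → ∀ a ∈ T, (∀ i, (D i ^ k i) a = 0) → a ∈ S by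
    choose k hk using hnil
    exact h _ k rfl a ha hk
  intro N
  induction N using Nat.strong_induction_on with
  | _ N ih =>
  intro k hkN a ha hk
  by_cases hsmall : ∀ i, k i ≤ 1
  · exact hker a ha fun i => by simpa using pow_apply_eq_zero_of_le (hsmall i) (hk i)
  push Not at hsmall
  obtain ⟨i, hi⟩ := hsmall
  obtain ⟨r, hr⟩ : ∃ r, k i = r + 1 := ⟨k i - 1, by lia⟩
  have hlt (t : ℕ) (ht : t < k i) : ∑ j, Function.update k i t j < N := by
    rw [← hkN]
    refine Finset.sum_lt_sum (fun j _ => ?_) ⟨i, Finset.mem_univ i, by simpa using ht⟩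
    rcases eq_or_ne j i with rfl | hj
    · simpa using ht.le
    · simp [hj]
  set b := (D i ^ r) a with hb
  have hbi : D i b = 0 := by rw [hb, ← pow_succ_apply, ← hr, hk i]
  have hbT : b ∈ T := hTpow i r a ha
  have hbj (j : ι) : (D j ^ k j) b = 0 := by rw [hb, hcommpow, hk, map_zero]
  have hbS : b ∈ S := by
    refine ih _ (hlt 1 hi) _ rfl b hbT fun j => ?_
    rcases eq_or_ne j i with rfl | hj
    · simpa using hbi
    · simpa [hj] using hbj j
  -- The leading Taylor term in `x i`. Since `D i b = 0`, subtracting it lowers the exponent at `i`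
  -- from `r + 1` to `r`; the other exponents do not grow because `D j` kills `x i`.
  set c : R := ((r.factorial : K)⁻¹) • (x i ^ r * b) with hc
  have hcT : c ∈ T := T.smul_mem (T.mul_mem (T.pow_mem (hTx i) r) hbT) _
  have hcS : c ∈ S := S.smul_mem (S.mul_mem (S.pow_mem (hSx i) r) hbS) _
  have hsub : a - c ∈ S := by
    refine ih _ (hlt r (by lia)) _ rfl (a - c) (T.sub_mem ha hcT) fun j => ?_
    rcases eq_or_ne j i with rfl | hj
    · rw [Function.update_self, map_sub, hc, map_smul, (hD j).pow_mul_of_ker_right _ hbi,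
        (hD j).pow_pow_slice (by simp [hx]), smul_mul_assoc, one_mul, ← Nat.cast_smul_eq_nsmul K,
        smul_smul, inv_mul_cancel₀ (by exact_mod_cast r.factorial_ne_zero), one_smul, sub_self]
    · rw [Function.update_of_ne hj, map_sub, hk, hc, map_smul,
        (hD j).pow_mul_of_ker_left ((hD j).map_pow_eq_zero (by simp [hx, hj]) r), hbj]
      simp
  simpa using S.add_mem hsub hcS

end Derivations

/-! ### Dimension bounds from above and independent families from below. -/

section Dimension

variable {K R : Type*} [Field K] [Ring R] [Algebra K R]

/-- A nilpotent operator of index `M` on `W` has a kernel of dimension at least `dim W / M`. -/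
theorem finrank_le_mul_finrank_inf_ker {D : R →ₗ[K] R} {W : Submodule K R} [FiniteDimensional K W]
    (hW : ∀ w ∈ W, D w ∈ W) {M : ℕ} (hM : ∀ w ∈ W, (D ^ M) w = 0) :
    Module.finrank K W ≤ M * Module.finrank K (W ⊓ LinearMap.ker D : Submodule K R) := by
  have hpow (k : ℕ) : ∀ w ∈ W, (D ^ k) w ∈ W := by
    induction k with
    | zero => exact fun w h => h
    | succ k ih => exact fun w h => by rw [pow_succ_apply]; exact hW _ (ih w h)
  -- `D ^ k` maps the part of `W` killed by `D ^ (k + 1)` into the part killed by `D`, with kernel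
  -- the part killed by `D ^ k`: rank-nullity adds at most one summand per step.
  have key (k : ℕ) : Module.finrank K (W ⊓ LinearMap.ker (D ^ k) : Submodule K R) ≤
      k * Module.finrank K (W ⊓ LinearMap.ker D : Submodule K R) := by
    induction k with
    | zero =>
      have : (W ⊓ LinearMap.ker (D ^ 0) : Submodule K R) = ⊥ := by
        ext a
        simp only [Submodule.mem_inf, LinearMap.mem_ker, pow_zero, Module.End.one_apply,
          Submodule.mem_bot]
        exact ⟨fun h => h.2, fun h => ⟨h ▸ W.zero_mem, h⟩⟩
      rw [this, finrank_bot]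
      exact Nat.zero_le _
    | succ k ih =>
      let U : Submodule K R := W ⊓ LinearMap.ker (D ^ (k + 1))
      have : FiniteDimensional K U := Submodule.finiteDimensional_of_le inf_le_left
      have h := LinearMap.finrank_range_add_finrank_ker ((D ^ k).domRestrict U)
      have h1 : Module.finrank K (LinearMap.range ((D ^ k).domRestrict U)) ≤
          Module.finrank K (W ⊓ LinearMap.ker D : Submodule K R) := by
        have : FiniteDimensional K (W ⊓ LinearMap.ker D : Submodule K R) :=
          Submodule.finiteDimensional_of_le inf_le_left
        refine Submodule.finrank_mono ?_
        rintro _ ⟨⟨u, hu⟩, rfl⟩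
        refine ⟨hpow k u hu.1, ?_⟩
        rw [SetLike.mem_coe, LinearMap.mem_ker, LinearMap.domRestrict_apply, ← pow_succ_apply]
        exact hu.2
      have h2 : Module.finrank K (LinearMap.ker ((D ^ k).domRestrict U)) ≤
          Module.finrank K (W ⊓ LinearMap.ker (D ^ k) : Submodule K R) := by
        have : FiniteDimensional K (W ⊓ LinearMap.ker (D ^ k) : Submodule K R) :=
          Submodule.finiteDimensional_of_le inf_le_left
        rw [← Submodule.finrank_map_subtype_eq]
        refine Submodule.finrank_mono ?_
        rintro _ ⟨⟨u, hu⟩, hk, rfl⟩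
        exact ⟨hu.1, hk⟩
      change Module.finrank K U ≤ _
      rw [← h, Nat.succ_mul]
      lia
  have h := key M
  rwa [inf_eq_left.2 (show W ≤ LinearMap.ker (D ^ M) from fun w hw => hM w hw)] at h

/-- Intersect with one kernel at a time. Commutativity keeps each intersection stable under the
remaining operators, and each cut costs at most a factor `M`. -/
theorem finrank_le_pow_mul_finrank {ι : Type*} [Fintype ι] {D : ι → R →ₗ[K] R}
    (hcomm : ∀ i j a, D i (D j a) = D j (D i a)) {V : Submodule K R} [FiniteDimensional K V]
    (hV : ∀ i, ∀ v ∈ V, D i v ∈ V) {M : ℕ} (hM : ∀ i, ∀ v ∈ V, (D i ^ M) v = 0) :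
    ∃ W ≤ V, (∀ i, ∀ w ∈ W, D i w = 0) ∧
      Module.finrank K V ≤ M ^ Fintype.card ι * Module.finrank K W := by
  classical
  suffices h : ∀ s : Finset ι, ∃ W ≤ V, (∀ i, ∀ w ∈ W, D i w ∈ W) ∧ (∀ i ∈ s, ∀ w ∈ W, D i w = 0) ∧
      Module.finrank K V ≤ M ^ s.card * Module.finrank K W by
    obtain ⟨W, h1, -, h2, h3⟩ := h Finset.univ
    exact ⟨W, h1, fun i => h2 i (Finset.mem_univ i), h3⟩
  intro s
  induction s using Finset.induction_on with
  | empty => exact ⟨V, le_rfl, hV, by simp, by simp⟩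
  | insert i s hi ih =>
    obtain ⟨W, h1, h2, h3, h4⟩ := ih
    have : FiniteDimensional K W := Submodule.finiteDimensional_of_le h1
    refine ⟨W ⊓ LinearMap.ker (D i), inf_le_left.trans h1, fun j w hw => ⟨h2 j w hw.1, ?_⟩,
      fun j hj w hw => ?_, ?_⟩
    · have := hw.2
      rw [SetLike.mem_coe, LinearMap.mem_ker] at this ⊢
      rw [hcomm, this, map_zero]
    · rcases Finset.mem_insert.1 hj with rfl | hj
      · exact hw.2
      · exact h3 j hj w hw.1
    · rw [Finset.card_insert_of_notMem hi, pow_succ, mul_assoc]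
      exact h4.trans (Nat.mul_le_mul_left _
        (finrank_le_mul_finrank_inf_ker (h2 i) fun w hw => hM i w (h1 hw)))

variable [CharZero K]

/-- A nonzero term `x ^ i * w i` has degree `i * d` with respect to `D`, so `D ^ (N * d)` isolates
the top term; the argument then descends. -/
theorem eq_zero_of_sum_pow_mul_eq_zero [Nontrivial R] [NoZeroDivisors R] {D : R →ₗ[K] R}
    (hD : IsDer D) {x : R} {d : ℕ} (hd : 0 < d) (hx : HasNilDegree D x d) {w : ℕ → R}
    (hw : ∀ i, D (w i) = 0) (N : ℕ) (hsum : ∑ i ∈ Finset.range N, x ^ i * w i = 0) :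
    ∀ i < N, w i = 0 := by
  induction N with
  | zero => simp
  | succ N ih =>
    have hlow : (D ^ (N * d)) (∑ i ∈ Finset.range N, x ^ i * w i) = 0 := by
      rw [map_sum]
      refine Finset.sum_eq_zero fun i hi => ?_
      have hi' : i + 1 ≤ N := Finset.mem_range.1 hi
      have hle : i * d + 1 ≤ N * d := by nlinarith
      rw [hD.pow_mul_of_ker_right _ (hw i), pow_apply_eq_zero_of_le hle (hx.pow hD i).2, zero_mul]
    have htop := congrArg (D ^ (N * d)) hsum
    rw [Finset.sum_range_succ, map_add, hlow, zero_add, map_zero,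
      hD.pow_mul_of_ker_right _ (hw N), mul_eq_zero] at htop
    have hN : w N = 0 := htop.resolve_left (hx.pow hD N).1
    rw [Finset.sum_range_succ, hN, mul_zero, add_zero] at hsum
    intro i hi
    rcases Nat.lt_succ_iff_lt_or_eq.1 hi with h | rfl
    · exact ih hsum i h
    · exact hN

theorem linearIndependent_pow_mul [Nontrivial R] [NoZeroDivisors R] {D : R →ₗ[K] R}
    (hD : IsDer D) {x : R} {d : ℕ} (hd : 0 < d) (hx : HasNilDegree D x d) {κ : Type*} [Fintype κ]
    {v : κ → R} (hv : LinearIndependent K v) (hDv : ∀ k, D (v k) = 0) (N : ℕ) :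
    LinearIndependent K fun p : Fin N × κ => x ^ (p.1 : ℕ) * v p.2 := by
  rw [Fintype.linearIndependent_iff] at hv ⊢
  intro g hg
  let w : ℕ → R := fun i => if h : i < N then ∑ k, g (⟨i, h⟩, k) • v k else 0
  have hw (i : ℕ) : D (w i) = 0 := by
    simp only [w]
    split_ifs
    · simp [map_sum, hDv]
    · exact map_zero D
  have hsum : ∑ i ∈ Finset.range N, x ^ i * w i = 0 := by
    rw [Finset.sum_range, ← hg, Fintype.sum_prod_type]
    refine Finset.sum_congr rfl fun i _ => ?_
    simp [w, Finset.mul_sum]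
  rintro ⟨i, k⟩
  have := eq_zero_of_sum_pow_mul_eq_zero hD hd hx hw N hsum i i.2
  simp only [w, i.2, dif_pos] at this
  exact hv _ this k

/-- Powers of elements in triangular position with respect to derivations extend a linearly
independent family of common constants. -/
theorem exists_linearIndependent_pow_mul [Nontrivial R] [NoZeroDivisors R] {ι : Type*} [Fintype ι]
    {D : ι → R →ₗ[K] R} (hD : ∀ i, IsDer (D i)) {x : ι → R} (hx : ∀ i j, i ≠ j → D i (x j) = 0)
    (hdeg : ∀ i, ∃ d, 0 < d ∧ HasNilDegree (D i) (x i) d) {V : Submodule K R} (hV : 1 ≤ V) {N e : ℕ}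
    {r : ℕ} (hxV : ∀ i, x i ∈ V ^ r) {κ : Type} [Fintype κ] {v : κ → R}
    (hv : LinearIndependent K v) (hDv : ∀ i k, D i (v k) = 0) (hvV : ∀ k, v k ∈ V ^ e) :
    ∃ (κ' : Type) (_ : Fintype κ') (v' : κ' → R), LinearIndependent K v' ∧
      Fintype.card κ' = N ^ Fintype.card ι * Fintype.card κ ∧
      (∀ k, v' k ∈ V ^ (Fintype.card ι * (r * N) + e)) ∧
      ∀ E : R →ₗ[K] R, IsDer E → (∀ i, E (x i) = 0) → (∀ k, E (v k) = 0) →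
        ∀ k, E (v' k) = 0 := by
  classical
  -- The last clause makes the induction run: applied to the next `D i`, it shows that the family
  -- built so far consists of constants of `D i`.
  suffices h : ∀ s : Finset ι, ∃ (κ' : Type) (_ : Fintype κ') (v' : κ' → R),
      LinearIndependent K v' ∧ Fintype.card κ' = N ^ s.card * Fintype.card κ ∧
      (∀ k, v' k ∈ V ^ (s.card * (r * N) + e)) ∧
      ∀ E : R →ₗ[K] R, IsDer E → (∀ i ∈ s, E (x i) = 0) → (∀ k, E (v k) = 0) →
        ∀ k, E (v' k) = 0 by
    obtain ⟨κ', h1, v', h2, h3, h4, h5⟩ := h Finset.univ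
    exact ⟨κ', h1, v', h2, h3, h4, fun E hE hx => h5 E hE fun i _ => hx i⟩
  intro s
  induction s using Finset.induction_on with
  | empty => exact ⟨κ, inferInstance, v, hv, by simp, by simpa using hvV, fun E _ _ h => h⟩
  | insert i s hi ih =>
    obtain ⟨κ', _, v', h2, h3, h4, h5⟩ := ih
    obtain ⟨d, hd, hdx⟩ := hdeg i
    have hDv' : ∀ k, D i (v' k) = 0 :=
      h5 (D i) (hD i) (fun j hj => hx i j fun h => hi (h ▸ hj)) (hDv i)
    refine ⟨Fin N × κ', inferInstance, _, linearIndependent_pow_mul (hD i) hd hdx h2 hDv' N,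
      ?_, ?_, ?_⟩
    · rw [Fintype.card_prod, Fintype.card_fin, h3, Finset.card_insert_of_notMem hi, pow_succ]
      ring
    · rintro ⟨k, l⟩
      have h6 : x i ^ (k : ℕ) * v' l ∈ V ^ (r * k) * V ^ (s.card * (r * N) + e) := by
        refine Submodule.mul_mem_mul ?_ (h4 l)
        rw [pow_mul]
        exact Submodule.pow_mem_pow _ (hxV i) k
      rw [← pow_add] at h6
      refine pow_le_pow_right₀ hV ?_ h6
      rw [Finset.card_insert_of_notMem hi, Nat.succ_mul]
      have := Nat.mul_le_mul_left r k.2.le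
      lia
    · rintro E hE hEx hEv ⟨k, l⟩
      rw [hE, hE.map_pow_eq_zero (hEx i (Finset.mem_insert_self i s)),
        h5 E hE (fun j hj => hEx j (Finset.mem_insert_of_mem hj)) hEv, zero_mul, mul_zero, add_zero]

end Dimension

/-! ### Coordinates with scalar commutators and the word-length filtration. -/

section Coordinates

variable {K R : Type*} [Field K] [Ring R] [Algebra K R] {ι : Type*}

/-- `D i` are the partial derivatives with respect to generators `x i` whose commutators are
scalars. -/
structure IsCoord [DecidableEq ι] (x : ι → R) (D : ι → R →ₗ[K] R) : Prop where
  isDer : ∀ i, IsDer (D i)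
  apply : ∀ i j, D i (x j) = if i = j then 1 else 0
  commutator : ∀ i j, ∃ c : K, x i * x j - x j * x i = algebraMap K R c
  adjoin : Algebra.adjoin K (Set.range x) = ⊤

/-- The span of `1` and the generators. -/
def genSpan (K : Type*) {R ι : Type*} [Field K] [Ring R] [Algebra K R] (x : ι → R) :
    Submodule K R :=
  Submodule.span K (insert 1 (Set.range x))

theorem one_le_genSpan (x : ι → R) : 1 ≤ genSpan K x :=
  Submodule.one_le.2 (Submodule.subset_span (Set.mem_insert _ _))

theorem mem_genSpan (x : ι → R) (i : ι) : x i ∈ genSpan K x :=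
  Submodule.subset_span (Set.mem_insert_of_mem _ ⟨i, rfl⟩)

instance finiteDimensional_genSpan_pow [Finite ι] (x : ι → R) (N : ℕ) :
    FiniteDimensional K (genSpan K x ^ N : Submodule K R) := by
  have h : (genSpan K x).FG := Submodule.fg_span ((Set.finite_range x).insert 1)
  exact Module.Finite.iff_fg.2 (h.pow N)

/-- Induction over products of a generator (or `1`) and an element of the filtration. -/
theorem genSpan_pow_succ_induction {x : ι → R} {N : ℕ} {U : Submodule K R}
    (h1 : ∀ w ∈ genSpan K x ^ N, w ∈ U) (hx : ∀ i, ∀ w ∈ genSpan K x ^ N, x i * w ∈ U) {v : R}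
    (hv : v ∈ genSpan K x ^ (N + 1)) : v ∈ U := by
  rw [pow_succ'] at hv
  refine (Submodule.mul_le.2 fun u hu w hw => ?_ : genSpan K x * genSpan K x ^ N ≤ U) hv
  induction hu using Submodule.span_induction with
  | mem u hu =>
    rcases hu with rfl | ⟨i, rfl⟩
    · rw [one_mul]; exact h1 w hw
    · exact hx i w hw
  | zero => rw [zero_mul]; exact U.zero_mem
  | add a b _ _ ha hb => rw [add_mul]; exact U.add_mem ha hb
  | smul r a _ ha => rw [smul_mul_assoc]; exact U.smul_mem r ha

theorem mul_mem_genSpan_pow_succ (x : ι → R) (i : ι) {N : ℕ} {w : R} (hw : w ∈ genSpan K x ^ N) :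
    x i * w ∈ genSpan K x ^ (N + 1) := by
  rw [pow_succ']
  exact Submodule.mul_mem_mul (mem_genSpan x i) hw

/-- If `E (x i)` is a scalar `b`, then `E (x i * w) = b * w + x i * E w`, so word length drops by
one by induction. -/
theorem IsDer.genSpan_pow_succ {E : R →ₗ[K] R} (hE : IsDer E) {x : ι → R}
    (hx : ∀ i, ∃ c : K, E (x i) = algebraMap K R c) (N : ℕ) :
    ∀ v ∈ genSpan K x ^ (N + 1), E v ∈ genSpan K x ^ N := by
  suffices h : ∀ v ∈ genSpan K x ^ (N + 1), v ∈ (genSpan K x ^ N).comap E from h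
  induction N with
  | zero =>
    refine fun v hv => genSpan_pow_succ_induction
      (U := (genSpan K x ^ 0).comap E) (fun w hw => ?_) (fun i w hw => ?_) hv
    · obtain ⟨c, rfl⟩ := Submodule.mem_one.1 (by simpa using hw)
      simp [hE.map_algebraMap]
    · obtain ⟨c, rfl⟩ := Submodule.mem_one.1 (by simpa using hw)
      obtain ⟨b, hb⟩ := hx i
      rw [Submodule.mem_comap, hE, hE.map_algebraMap, hb, mul_zero, add_zero, ← map_mul, pow_zero]
      exact Submodule.mem_one.2 ⟨_, rfl⟩
  | succ N ih =>
    have hle : genSpan K x ^ N ≤ genSpan K x ^ (N + 1) :=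
      pow_le_pow_right₀ (one_le_genSpan x) (Nat.le_succ N)
    refine fun v hv => genSpan_pow_succ_induction
      (U := (genSpan K x ^ (N + 1)).comap E) (fun w hw => hle (ih w hw)) (fun i w hw => ?_) hv
    obtain ⟨b, hb⟩ := hx i
    rw [Submodule.mem_comap, hE, hb, ← Algebra.smul_def]
    exact Submodule.add_mem _ (Submodule.smul_mem _ _ hw) (mul_mem_genSpan_pow_succ x i (ih w hw))

theorem IsDer.pow_genSpan_eq_zero {E : R →ₗ[K] R} (hE : IsDer E) {x : ι → R}
    (hx : ∀ i, ∃ c : K, E (x i) = algebraMap K R c) (N : ℕ) :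
    ∀ v ∈ genSpan K x ^ N, (E ^ (N + 1)) v = 0 := by
  induction N with
  | zero =>
    intro v hv
    obtain ⟨c, rfl⟩ := Submodule.mem_one.1 (by simpa using hv)
    simp [hE.map_algebraMap]
  | succ N ih =>
    intro v hv
    rw [pow_succ_apply']
    exact ih _ (hE.genSpan_pow_succ hx N v hv)

namespace IsCoord

variable [DecidableEq ι] {x : ι → R} {D : ι → R →ₗ[K] R}

theorem exists_mem_genSpan_pow (h : IsCoord x D) (a : R) : ∃ N, a ∈ genSpan K x ^ N := by
  have hmono {k l : ℕ} (hkl : k ≤ l) : genSpan K x ^ k ≤ genSpan K x ^ l :=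
    pow_le_pow_right₀ (one_le_genSpan x) hkl
  have ha : a ∈ Algebra.adjoin K (Set.range x) := h.adjoin ▸ trivial
  induction ha using Algebra.adjoin_induction with
  | mem y hy =>
    obtain ⟨i, rfl⟩ := hy
    exact ⟨1, by rw [pow_one]; exact mem_genSpan x i⟩
  | algebraMap r => exact ⟨0, by rw [pow_zero]; exact Submodule.mem_one.2 ⟨r, rfl⟩⟩
  | add a b _ _ ha hb =>
    obtain ⟨k, hk⟩ := ha
    obtain ⟨l, hl⟩ := hb
    exact ⟨k + l, Submodule.add_mem _ (hmono (by lia) hk) (hmono (by lia) hl)⟩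
  | mul a b _ _ ha hb =>
    obtain ⟨k, hk⟩ := ha
    obtain ⟨l, hl⟩ := hb
    exact ⟨k + l, by rw [pow_add]; exact Submodule.mul_mem_mul hk hl⟩

theorem apply_scalar (h : IsCoord x D) (i j : ι) : ∃ c : K, D i (x j) = algebraMap K R c := by
  rw [h.apply]
  split_ifs
  · exact ⟨1, by simp⟩
  · exact ⟨0, by simp⟩

/-- The commutator is a derivation, and it kills the generators because first derivatives of
generators are scalars. -/
theorem comm (h : IsCoord x D) (i j : ι) (a : R) : D i (D j a) = D j (D i a) := by
  refine sub_eq_zero.1 (((h.isDer i).commutator (h.isDer j)).eq_zero_of_adjoin h.adjoin ?_ a)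
  rintro _ ⟨k, rfl⟩
  obtain ⟨b, hb⟩ := h.apply_scalar i k
  obtain ⟨c, hc⟩ := h.apply_scalar j k
  simp [hb, hc, (h.isDer _).map_algebraMap]

theorem nilpotent (h : IsCoord x D) (i : ι) (a : R) : ∃ k, (D i ^ k) a = 0 := by
  obtain ⟨N, hN⟩ := h.exists_mem_genSpan_pow a
  exact ⟨N + 1, (h.isDer i).pow_genSpan_eq_zero (h.apply_scalar i) N a hN⟩

variable [Fintype ι]

/-- The Euler operator acts on the `N + 1`-st layer of the filtration as `N + 1`. -/
theorem euler (h : IsCoord x D) (N : ℕ) : ∀ v ∈ genSpan K x ^ (N + 1),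
    ∑ i, x i * D i v - (N + 1 : ℕ) • v ∈ genSpan K x ^ N := by
  let L (N : ℕ) : R →ₗ[K] R :=
    ∑ i, LinearMap.mulLeft K (x i) ∘ₗ D i - (N + 1 : ℕ) • LinearMap.id
  have hL (N : ℕ) (v : R) : L N v = ∑ i, x i * D i v - (N + 1 : ℕ) • v := by
    simp only [L, LinearMap.sub_apply, LinearMap.sum_apply, LinearMap.comp_apply,
      LinearMap.mulLeft_apply, LinearMap.smul_apply, LinearMap.id_apply]
  -- Noncommutativity contributes only the last sum: its commutators are scalars, so it is a
  -- combination of the `D i w` and lies in a lower layer.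
  have hgen (j : ι) (w : R) :
      ∑ i, x i * D i (x j * w) = x j * w + x j * ∑ i, x i * D i w +
        ∑ i, (x i * x j - x j * x i) * D i w := by
    have : ∀ i, x i * D i (x j * w) = (if i = j then x i * w else 0) + x j * (x i * D i w) +
        (x i * x j - x j * x i) * D i w := by
      intro i
      rw [h.isDer, h.apply]
      split_ifs <;> noncomm_ring
    simp only [this, Finset.sum_add_distrib, Finset.mul_sum, Finset.sum_ite_eq', Finset.mem_univ,
      if_true]
  suffices hs : ∀ v ∈ genSpan K x ^ (N + 1), v ∈ (genSpan K x ^ N).comap (L N) by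
    intro v hv
    rw [← hL]
    exact hs v hv
  induction N with
  | zero =>
    refine fun v hv => genSpan_pow_succ_induction (fun w hw => ?_) (fun j w hw => ?_) hv
    · obtain ⟨c, rfl⟩ := Submodule.mem_one.1 (by simpa using hw)
      rw [Submodule.mem_comap, hL]
      simp only [(h.isDer _).map_algebraMap, mul_zero, Finset.sum_const_zero, zero_add, one_smul,
        zero_sub, pow_zero]
      exact Submodule.neg_mem _ (Submodule.mem_one.2 ⟨c, rfl⟩)
    · obtain ⟨c, rfl⟩ := Submodule.mem_one.1 (by simpa using hw)
      rw [Submodule.mem_comap, hL, hgen]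
      simp [(h.isDer _).map_algebraMap]
  | succ N ih =>
    refine fun v hv => genSpan_pow_succ_induction (fun w hw => ?_) (fun j w hw => ?_) hv
    · rw [Submodule.mem_comap, hL]
      refine Submodule.sub_mem _ (Submodule.sum_mem _ fun i _ => ?_)
        (nsmul_mem hw _)
      exact mul_mem_genSpan_pow_succ x i
        ((h.isDer i).genSpan_pow_succ (h.apply_scalar i) N w hw)
    · have h1 := ih w hw
      rw [Submodule.mem_comap, hL] at h1 ⊢
      have : x j * w + x j * ∑ i, x i * D i w + ∑ i, (x i * x j - x j * x i) * D i w -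
          (N + 1 + 1 : ℕ) • (x j * w) = x j * (∑ i, x i * D i w - (N + 1 : ℕ) • w) +
            ∑ i, (x i * x j - x j * x i) * D i w := by
        rw [mul_sub, succ_nsmul _ (N + 1), mul_smul_comm]
        abel
      rw [hgen, this]
      refine Submodule.add_mem _ (mul_mem_genSpan_pow_succ x j h1) (Submodule.sum_mem _ fun i _ => ?_)
      obtain ⟨c, hc⟩ := h.commutator i j
      rw [hc, ← Algebra.smul_def]
      exact Submodule.smul_mem _ _ (pow_le_pow_right₀ (one_le_genSpan x) (Nat.le_succ N)
        ((h.isDer i).genSpan_pow_succ (h.apply_scalar i) N w hw))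

variable [CharZero K]

/-- On a common constant the Euler sum vanishes, so `(N + 1) • a` falls into layer `N`; dividing by
`N + 1` descends to layer zero, the scalars. -/
theorem exists_algebraMap (h : IsCoord x D) {a : R} (ha : ∀ i, D i a = 0) :
    ∃ c : K, algebraMap K R c = a := by
  obtain ⟨N, hN⟩ := h.exists_mem_genSpan_pow a
  induction N with
  | zero => exact Submodule.mem_one.1 (by simpa using hN)
  | succ N ih =>
    refine ih ?_
    have := h.euler N a hN
    simp only [ha, mul_zero, Finset.sum_const_zero, zero_sub] at this
    rw [neg_mem_iff, ← Nat.cast_smul_eq_nsmul K] at this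
    exact (Submodule.smul_mem_iff _ (by exact_mod_cast N.succ_ne_zero)).1 this

/-- If `a * b = 0`, leading derivatives of `a` and `b` again multiply to zero. Descending along all
`D i` turns `a` into a nonzero scalar that annihilates a nonzero element. -/
theorem noZeroDivisors [Nontrivial R] (h : IsCoord x D) : NoZeroDivisors R := by
  refine ⟨fun {a b} hab => or_iff_not_imp_left.2 fun ha => by_contra fun hb => ?_⟩
  obtain ⟨c, ⟨e, he, hce⟩, hc, hcD⟩ := exists_mem_ker_of_hasNilDegree h.comm h.nilpotent
    (Q := fun a => ∃ b, b ≠ 0 ∧ a * b = 0) (by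
      rintro i a d ⟨b, hb, hab⟩ hd
      obtain ⟨e, he⟩ := exists_hasNilDegree hb (h.nilpotent i b)
      refine ⟨_, he.1, ?_⟩
      have := (h.isDer i).pow_mul_top hd.2 he.2
      rw [hab, map_zero, eq_comm,
        nsmul_eq_zero_iff_of_algebra (K := K) (Nat.choose_pos (by lia)).ne'] at this
      exact this) ⟨b, hb, hab⟩ ha
  obtain ⟨r, rfl⟩ := h.exists_algebraMap hcD
  rw [← Algebra.smul_def, smul_eq_zero] at hce
  rcases hce with rfl | hce
  · exact hc (map_zero _)
  · exact he hce

theorem finrank_genSpan_pow_le (h : IsCoord x D) (N : ℕ) :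
    Module.finrank K (genSpan K x ^ N : Submodule K R) ≤ (N + 1) ^ Fintype.card ι := by
  obtain ⟨W, -, hWD, hW⟩ := finrank_le_pow_mul_finrank h.comm (V := genSpan K x ^ N) (M := N + 1)
    (fun i v hv => (h.isDer i).genSpan_pow_succ (h.apply_scalar i) N v
      (pow_le_pow_right₀ (one_le_genSpan x) (Nat.le_succ N) hv))
    (fun i v hv => (h.isDer i).pow_genSpan_eq_zero (h.apply_scalar i) N v hv)
  refine hW.trans (mul_le_of_le_one_right (Nat.zero_le _) ?_)
  have hle : W ≤ Submodule.span K {(1 : R)} := by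
    intro w hw
    obtain ⟨c, rfl⟩ := h.exists_algebraMap fun i => hWD i w hw
    rw [Algebra.algebraMap_eq_smul_one]
    exact Submodule.smul_mem _ _ (Submodule.mem_span_singleton_self 1)
  have hspan : Module.finrank K (Submodule.span K {(1 : R)}) ≤ 1 := by
    simpa using finrank_span_le_card (R := K) ({1} : Set R)
  exact (Submodule.finrank_mono hle).trans hspan

theorem card_le_of_linearIndependent (h : IsCoord x D) {κ : Type*} [Fintype κ] {v : κ → R}
    (hv : LinearIndependent K v) {N : ℕ} (hN : ∀ k, v k ∈ genSpan K x ^ N) :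
    Fintype.card κ ≤ (N + 1) ^ Fintype.card ι := by
  refine le_trans ?_ (h.finrank_genSpan_pow_le N)
  let w : κ → (genSpan K x ^ N : Submodule K R) := fun k => ⟨v k, hN k⟩
  have hw : LinearIndependent K w :=
    LinearIndependent.of_comp (Submodule.subtype _) hv
  exact hw.fintype_card_le_finrank

end IsCoord

end Coordinates

/-! ### Families satisfying the Weyl relations and their inner derivations. -/

section WeylFamily

variable {K R R' : Type*} [Field K] [Ring R] [Algebra K R] [Ring R'] [Algebra K R'] {n : ℕ}

/-- A family satisfying the relations of the Weyl algebra. -/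
structure IsWeylFamily (u : Fin n ⊕ Fin n → R) : Prop where
  pq : ∀ i j, u (Sum.inr i) * u (Sum.inl j) =
    u (Sum.inl j) * u (Sum.inr i) + if i = j then 1 else 0
  pp : ∀ i j, u (Sum.inr i) * u (Sum.inr j) = u (Sum.inr j) * u (Sum.inr i)
  qq : ∀ i j, u (Sum.inl i) * u (Sum.inl j) = u (Sum.inl j) * u (Sum.inl i)

/-- The inner derivations `[p_i, ·]` and `-[q_i, ·]`. -/
def weylDer (K : Type*) {R : Type*} [Field K] [Ring R] [Algebra K R] {n : ℕ}
    (u : Fin n ⊕ Fin n → R) : Fin n ⊕ Fin n → R →ₗ[K] R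
  | Sum.inl i => ad K (u (Sum.inr i))
  | Sum.inr i => -ad K (u (Sum.inl i))

theorem isDer_weylDer (u : Fin n ⊕ Fin n → R) (b : Fin n ⊕ Fin n) : IsDer (weylDer K u b) := by
  cases b with
  | inl i => exact isDer_ad _
  | inr i => exact (isDer_ad _).neg

theorem map_weylDer (τ : R →ₐ[K] R') (u : Fin n ⊕ Fin n → R) (b : Fin n ⊕ Fin n) (a : R) :
    τ (weylDer K u b a) = weylDer K (τ ∘ u) b (τ a) := by
  cases b <;> simp [weylDer, ad_apply]

theorem weylDer_eq_zero {u : Fin n ⊕ Fin n → R} {a : R} (h : ∀ b, u b * a = a * u b)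
    (b : Fin n ⊕ Fin n) : weylDer K u b a = 0 := by
  cases b <;> simp [weylDer, ad_apply, h]

theorem commute_of_weylDer_eq_zero {u : Fin n ⊕ Fin n → R} {a : R} (h : ∀ b, weylDer K u b a = 0)
    (b : Fin n ⊕ Fin n) : u b * a = a * u b := by
  cases b with
  | inl i => exact sub_eq_zero.1 (neg_eq_zero.1 (h (Sum.inr i)))
  | inr i => simpa [weylDer, ad_apply, sub_eq_zero] using h (Sum.inl i)

theorem weylDer_mem {T : Subalgebra K R} {u : Fin n ⊕ Fin n → R} (hu : ∀ b, u b ∈ T)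
    (b : Fin n ⊕ Fin n) {a : R} (ha : a ∈ T) : weylDer K u b a ∈ T := by
  cases b with
  | inl i => exact T.sub_mem (T.mul_mem (hu _) ha) (T.mul_mem ha (hu _))
  | inr i => exact T.neg_mem (T.sub_mem (T.mul_mem (hu _) ha) (T.mul_mem ha (hu _)))

namespace IsWeylFamily

variable {u : Fin n ⊕ Fin n → R}

theorem map (hu : IsWeylFamily u) (τ : R →ₐ[K] R') : IsWeylFamily (τ ∘ u) where
  pq i j := by
    have := congrArg τ (hu.pq i j)
    simpa [apply_ite τ] using this
  pp i j := by simpa using congrArg τ (hu.pp i j)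
  qq i j := by simpa using congrArg τ (hu.qq i j)

theorem weylDer_apply (hu : IsWeylFamily u) (b c : Fin n ⊕ Fin n) :
    weylDer K u b (u c) = if b = c then 1 else 0 := by
  rcases b with i | i <;> rcases c with j | j
  · simp [weylDer, ad_apply, hu.pq]
  · simp [weylDer, ad_apply, hu.pp i j]
  · simp [weylDer, ad_apply, hu.qq i j]
  · simp [weylDer, ad_apply, hu.pq, eq_comm]

theorem exists_commutator (hu : IsWeylFamily u) (b c : Fin n ⊕ Fin n) :
    ∃ r : K, u b * u c - u c * u b = algebraMap K R r := by
  rcases b with i | i <;> rcases c with j | j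
  · exact ⟨0, by simp [hu.qq i j]⟩
  · exact ⟨if j = i then -1 else 0, by rw [hu.pq]; split_ifs <;> simp⟩
  · exact ⟨if i = j then 1 else 0, by rw [hu.pq]; split_ifs <;> simp⟩
  · exact ⟨0, by simp [hu.pp i j]⟩

/-- The commutator of `ad v` and `ad w` is `ad` of the commutator of `v` and `w`, which is a scalar
here. -/
theorem weylDer_comm (hu : IsWeylFamily u) (b c : Fin n ⊕ Fin n) (a : R) :
    weylDer K u b (weylDer K u c a) = weylDer K u c (weylDer K u b a) := by
  have key (v w : R) (hvw : ∃ r : K, v * w - w * v = algebraMap K R r) :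
      ad K v (ad K w a) = ad K w (ad K v a) := by
    obtain ⟨r, hr⟩ := hvw
    have h := Algebra.commutes r a
    rw [← hr, ← sub_eq_zero] at h
    rw [← sub_eq_zero, ← h]
    simp only [ad_apply]
    noncomm_ring
  rcases b with i | i <;> rcases c with j | j <;>
    simp only [weylDer, LinearMap.neg_apply, map_neg, key _ _ (hu.exists_commutator _ _)]

end IsWeylFamily

end WeylFamily

/-! ### Centralizers of Weyl families by a growth argument. -/

section Model

variable {K R : Type*} [Field K] [Ring R] [Algebra K R] {n m : ℕ}

/-- `R` is generated by a copy `x (Sum.inl ·)` of the generators of the Weyl algebra and by central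
variables `x (Sum.inr ·)`, the images under `ι` of the variables of a polynomial algebra, and
`∂ l` are partial derivatives with respect to the central variables. -/
structure IsModel (x : Gen n m → R) (ι : MvPolynomial (Fin m) K →ₐ[K] R)
    (d : Fin m → R →ₗ[K] R) : Prop where
  weyl : IsWeylFamily fun b => x (Sum.inl b)
  ι_X : ∀ l, ι (MvPolynomial.X l) = x (Sum.inr l)
  ι_comm : ∀ f a, ι f * a = a * ι f
  isDer : ∀ l, IsDer (d l)
  d_ι : ∀ l f, d l (ι f) = ι (MvPolynomial.pderiv l f)
  d_inl : ∀ l b, d l (x (Sum.inl b)) = 0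
  adjoin : Algebra.adjoin K (Set.range x) = ⊤

/-- The partial derivatives with respect to all the generators. -/
def modelDer (x : Gen n m → R) (d : Fin m → R →ₗ[K] R) : Gen n m → R →ₗ[K] R
  | Sum.inl b => weylDer K (fun b => x (Sum.inl b)) b
  | Sum.inr l => d l

namespace IsModel

variable {x : Gen n m → R} {ι : MvPolynomial (Fin m) K →ₐ[K] R} {d : Fin m → R →ₗ[K] R}

theorem weylDer_ι (h : IsModel x ι d) (u : Fin n ⊕ Fin n → R) (b : Fin n ⊕ Fin n)
    (f : MvPolynomial (Fin m) K) : weylDer K u b (ι f) = 0 :=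
  weylDer_eq_zero (fun _ => (h.ι_comm _ _).symm) b

theorem isCoord (h : IsModel x ι d) : IsCoord x (modelDer x d) where
  isDer g := by
    cases g with
    | inl b => exact isDer_weylDer _ _
    | inr l => exact h.isDer l
  apply g g' := by
    rcases g with b | l <;> rcases g' with c | k
    · simpa [modelDer] using h.weyl.weylDer_apply b c
    · simpa [modelDer, h.ι_X] using h.weylDer_ι (fun b => x (Sum.inl b)) b (MvPolynomial.X k)
    · simpa [modelDer] using h.d_inl l c
    · simp only [modelDer, ← h.ι_X, h.d_ι, MvPolynomial.pderiv_X, Sum.inr.injEq,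
        Pi.single_apply, eq_comm (a := k)]
      split_ifs <;> simp
  commutator g g' := by
    rcases g with b | l
    · rcases g' with c | k
      · exact h.weyl.exists_commutator b c
      · exact ⟨0, by rw [← h.ι_X, h.ι_comm, sub_self, map_zero]⟩
    · exact ⟨0, by rw [← h.ι_X, h.ι_comm, sub_self, map_zero]⟩
  adjoin := h.adjoin

variable [CharZero K]

/-- The centralizer of the Weyl algebra consists of polynomials in the central variables. -/
theorem mem_range_of_weylDer_eq_zero (h : IsModel x ι d) {a : R}
    (ha : ∀ b, weylDer K (fun b => x (Sum.inl b)) b a = 0) : a ∈ ι.range := by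
  have hc := h.isCoord
  -- The centralizer is stable under the central partial derivatives, so Taylor expansion in the
  -- central variables can be carried out inside it, with scalar coefficients.
  let T : Subalgebra K R :=
    { carrier := {a | ∀ b : Fin n ⊕ Fin n, modelDer x d (Sum.inl b) a = 0}
      mul_mem' := fun {a c} ha hc' b => by
        rw [(hc.isDer _), ha b, hc' b, zero_mul, mul_zero, add_zero]
      add_mem' := fun {a c} ha hc' b => by rw [map_add, ha b, hc' b, add_zero]
      algebraMap_mem' := fun r b => (hc.isDer _).map_algebraMap r }
  refine mem_of_nilpotent (D := fun l : Fin m => modelDer x d (Sum.inr l))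
    (x := fun l => x (Sum.inr l)) (T := T) (S := ι.range)
    (fun l => hc.isDer _) (fun i j => hc.comm _ _)
    (fun i j => ?_) (fun i b => ?_) (fun i a ha b => ?_) (fun i => ⟨_, h.ι_X i⟩) (fun a ha h => ?_)
    ha fun l => hc.nilpotent _ _
  · simpa using hc.apply (Sum.inr i) (Sum.inr j)
  · simpa using hc.apply (Sum.inl b) (Sum.inr i)
  · rw [hc.comm, ha b, map_zero]
  · obtain ⟨c, rfl⟩ := hc.exists_algebraMap (a := a) (by
      rintro (b | l)
      · exact ha b
      · exact h l)
    exact Subalgebra.algebraMap_mem _ c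

/-- The centralizer of any copy of the Weyl algebra consists of polynomials in the central
variables. -/
theorem mem_range_of_commute [Nontrivial R] (h : IsModel x ι d) {u : Fin n ⊕ Fin n → R}
    (hu : IsWeylFamily u) {c : R} (hcu : ∀ b, u b * c = c * u b) : c ∈ ι.range := by
  by_contra hcon
  have hc := h.isCoord
  have := hc.noZeroDivisors
  -- Being outside $P_m$, `c` is not constant for some original Weyl derivative, which will separate
  -- its powers.
  obtain ⟨b₀, hb₀⟩ : ∃ b, modelDer x d (Sum.inl b) c ≠ 0 := by
    by_contra! h'
    exact hcon (h.mem_range_of_weylDer_eq_zero h')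
  obtain ⟨k, hk⟩ : ∃ k, HasNilDegree (modelDer x d (Sum.inl b₀)) c k :=
    exists_hasNilDegree (by rintro rfl; exact hb₀ (map_zero _)) (hc.nilpotent _ c)
  have hkpos : 0 < k := by
    rcases Nat.eq_zero_or_pos k with rfl | hpos
    · exact absurd (by simpa using hk.2) hb₀
    · exact hpos
  have hV := one_le_genSpan (K := K) x
  choose ru hru using fun b => hc.exists_mem_genSpan_pow (u b)
  obtain ⟨rc, hrc⟩ := hc.exists_mem_genSpan_pow c
  let r := ∑ b, ru b + rc + 1
  have hru' (b) : u b ∈ genSpan K x ^ r :=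
    pow_le_pow_right₀ hV (by
      have := Finset.single_le_sum (f := ru) (fun _ _ => Nat.zero_le _) (Finset.mem_univ b)
      lia) (hru b)
  have hrc' : c ∈ genSpan K x ^ r := pow_le_pow_right₀ hV (by lia) hrc
  have hrg (g) : x g ∈ genSpan K x ^ r := by
    refine pow_le_pow_right₀ hV (by lia : 1 ≤ r) ?_
    rw [pow_one]
    exact mem_genSpan _ _
  have hone (D : R →ₗ[K] R) (hD : IsDer D) {y : R} (hy : D y = 1) :
      ∃ k, 0 < k ∧ HasNilDegree D y k :=
    ⟨1, one_pos, by simp [hy], by rw [pow_succ_apply, pow_one, hy, hD.map_one]⟩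
  -- Independence is built in triangular order: central variables by their partial derivatives, then
  -- `c` by the derivation at `b₀`, then `u` by its own inner derivations. Each new derivation kills
  -- everything adjoined before. The `2 * n + m + 1` elements multiplied each have filtration degree
  -- at most `r`.
  have key (N : ℕ) : N ^ (2 * n + m + 1) ≤ ((2 * n + m + 1) * (r * N) + 1) ^ (2 * n + m) := by
    obtain ⟨κ₁, _, v₁, h1, h2, h3, h4⟩ := exists_linearIndependent_pow_mul
      (D := fun l : Fin m => modelDer x d (Sum.inr l)) (x := fun l => x (Sum.inr l))
      (N := N) (e := 0) (κ := Unit) (v := fun _ => 1)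
      (fun l => hc.isDer _) (fun i j hij => by rw [hc.apply, if_neg (by simpa using hij)])
      (fun l => hone _ (hc.isDer _) (by simp [hc.apply])) hV (fun l => hrg _)
      (LinearIndependent.of_subsingleton () one_ne_zero) (fun _ _ => (hc.isDer _).map_one)
      (fun _ => by rw [pow_zero]; exact Submodule.one_le.1 le_rfl)
    obtain ⟨κ₂, _, v₂, i1, i2, i3, i4⟩ := exists_linearIndependent_pow_mul
      (D := fun _ : Unit => modelDer x d (Sum.inl b₀)) (x := fun _ => c)
      (N := N) (fun _ => hc.isDer _) (fun i j hij => absurd (Subsingleton.elim i j) hij)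
      (fun _ => ⟨k, hkpos, hk⟩) hV (fun _ => hrc') h1
      (fun _ => h4 _ (hc.isDer _) (fun l => by simp [hc.apply]) fun _ => (hc.isDer _).map_one) h3
    obtain ⟨κ₃, _, v₃, j1, j2, j3, -⟩ := exists_linearIndependent_pow_mul
      (D := weylDer K u) (x := u) (N := N) (fun b => isDer_weylDer u b)
      (fun i j hij => by rw [hu.weylDer_apply, if_neg hij])
      (fun b => hone _ (isDer_weylDer u b) (by simp [hu.weylDer_apply])) hV hru' i1
      (fun b => i4 _ (isDer_weylDer u b) (fun _ => weylDer_eq_zero hcu b)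
        (h4 _ (isDer_weylDer u b) (fun l => by rw [← h.ι_X, h.weylDer_ι])
          fun _ => (isDer_weylDer u b).map_one)) i3
    have := hc.card_le_of_linearIndependent j1 j3
    rw [j2, i2, h2] at this
    simp only [Fintype.card_sum, Fintype.card_fin, Fintype.card_unit] at this
    convert this using 2 <;> ring
  -- With `s = 2 * n + m`, the bound becomes `N ^ (s + 1) ≤ (t * N) ^ s`, that is `N ≤ t ^ s`; the
  -- choice `N = t ^ s + 1` violates it.
  set t := (2 * n + m + 1) * r + 1
  have hN := key (t ^ (2 * n + m) + 1)
  set N := t ^ (2 * n + m) + 1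
  have h1 : (2 * n + m + 1) * (r * N) + 1 ≤ t * N := by
    have : t * N = (2 * n + m + 1) * (r * N) + N := by simp only [t]; ring
    lia
  have h2 := hN.trans (Nat.pow_le_pow_left h1 _)
  rw [mul_pow, pow_succ', Nat.mul_le_mul_right_iff (by positivity)] at h2
  lia

end IsModel

end Model

/-! ### Leibniz determinants with at most one noncentral row. -/

section LeibnizDet

variable {S R : Type*} [CommRing S] [Ring R] {m : ℕ}

/-- All other factors are central, so the exceptional one can be moved to the front. -/
theorem list_prod_ofFn_update {m : ℕ} (g : Fin m → R) (j : Fin m) (a : R)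
    (hg : ∀ i b, g i * b = b * g i) :
    (List.ofFn (Function.update g j a)).prod = a * (List.ofFn (Function.update g j 1)).prod := by
  induction m with
  | zero => exact j.elim0
  | succ m ih =>
    rw [List.ofFn_succ, List.ofFn_succ, List.prod_cons, List.prod_cons]
    rcases Fin.eq_zero_or_eq_succ j with rfl | ⟨j, rfl⟩
    · simp
    · have key (c : R) : (fun i : Fin m => Function.update g j.succ c i.succ) =
          Function.update (fun i => g i.succ) j c := by
        funext i
        rcases eq_or_ne i j with rfl | h
        · simp
        · simp [h]
      rw [key, key, ih (fun i => g i.succ) j fun i => hg i.succ,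
        Function.update_of_ne (Fin.succ_ne_zero j).symm,
        Function.update_of_ne (Fin.succ_ne_zero j).symm, ← mul_assoc, hg, mul_assoc]

theorem list_prod_ofFn_map (φ : S →+* R) (g : Fin m → S) :
    (List.ofFn fun i => φ (g i)).prod = φ (∏ i, g i) := by
  rw [← List.prod_ofFn, map_list_prod, List.map_ofFn]
  rfl

theorem det_eq_sum_rows (M : Matrix (Fin m) (Fin m) S) :
    M.det = ∑ π : Equiv.Perm (Fin m), (Equiv.Perm.sign π : ℤ) • ∏ i, M i (π i) := by
  rw [← Matrix.det_transpose, Matrix.det_apply]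
  rfl

theorem leibnizDet_map (φ : S →+* R) (M : Matrix (Fin m) (Fin m) S) :
    leibnizDet (M.map φ) = φ M.det := by
  rw [det_eq_sum_rows, map_sum, leibnizDet]
  refine Finset.sum_congr rfl fun π _ => ?_
  rw [map_zsmul, ← list_prod_ofFn_map]
  rfl

/-- Expansion of a determinant with central entries outside of one row along that row. -/
theorem leibnizDet_updateRow (φ : S →+* R) (hφ : ∀ s a, φ s * a = a * φ s)
    (M : Matrix (Fin m) (Fin m) S) (j : Fin m) (u : Fin m → R) :
    leibnizDet ((M.map φ).updateRow j u) = ∑ l, u l * φ (M.adjugate l j) := by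
  have hL (π : Equiv.Perm (Fin m)) :
      (List.ofFn fun i => ((M.map φ).updateRow j u) i (π i)).prod =
        u (π j) * φ (∏ i, Function.update (fun i => M i (π i)) j 1 i) := by
    have h1 (c : Fin m → R) : (fun i => ((M.map φ).updateRow j c) i (π i)) =
        Function.update (fun i => φ (M i (π i))) j (c (π j)) := by
      funext i
      rcases eq_or_ne i j with rfl | h
      · simp
      · simp [h]
    rw [h1, list_prod_ofFn_update _ _ _ fun i b => hφ _ b, ← list_prod_ofFn_map]
    congr 3
    funext i
    rcases eq_or_ne i j with rfl | h
    · simp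
    · simp [h]
  -- `adjugate l j` is the determinant with row `j` replaced by the unit vector at `l`; only
  -- permutations with `π j = l` contribute.
  have hR (π : Equiv.Perm (Fin m)) (l : Fin m) :
      ∏ i, (M.updateRow j (Pi.single l 1)) i (π i) =
        if π j = l then ∏ i, Function.update (fun i => M i (π i)) j 1 i else 0 := by
    split_ifs with h
    · refine Finset.prod_congr rfl fun i _ => ?_
      rcases eq_or_ne i j with rfl | hij
      · simp [h]
      · simp [hij]
    · exact Finset.prod_eq_zero (Finset.mem_univ j) (by simp [h])
  simp only [leibnizDet, hL, Matrix.adjugate_apply, det_eq_sum_rows, hR, map_sum, map_zsmul,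
    Finset.mul_sum]
  rw [Finset.sum_comm]
  refine Finset.sum_congr rfl fun π _ => ?_
  simp only [zsmul_eq_mul, apply_ite φ, map_zero, mul_ite, mul_zero, Finset.sum_ite_eq,
    Finset.mem_univ, if_true]
  rw [← mul_assoc, ← mul_assoc, (Int.cast_commute _ _).eq]

end LeibnizDet

/-! ### Derivations dual to a tuple with constant Jacobian determinant. -/

section Jacobian

variable {K R : Type*} [Field K] [Ring R] [Algebra K R] {n m : ℕ}

/-- The Jacobian matrix of a tuple of polynomials. -/
def polyJac (f : Fin m → MvPolynomial (Fin m) K) :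
    Matrix (Fin m) (Fin m) (MvPolynomial (Fin m) K) :=
  Matrix.of fun k l => MvPolynomial.pderiv l (f k)

/-- The derivation `a ↦ Δ⁻¹ det (…)` attached to a tuple of polynomials `f` with Jacobian
determinant `Δ`, dual to the tuple. -/
def jacDer (ι : MvPolynomial (Fin m) K →ₐ[K] R) (d : Fin m → R →ₗ[K] R)
    (f : Fin m → MvPolynomial (Fin m) K) (Δ : K) (j : Fin m) : R →ₗ[K] R :=
  Δ⁻¹ • ∑ l, LinearMap.mulRight K (ι ((polyJac f).adjugate l j)) ∘ₗ d l

theorem jacDer_apply (ι : MvPolynomial (Fin m) K →ₐ[K] R) (d : Fin m → R →ₗ[K] R)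
    (f : Fin m → MvPolynomial (Fin m) K) (Δ : K) (j : Fin m) (a : R) :
    jacDer ι d f Δ j a = Δ⁻¹ • ∑ l, d l a * ι ((polyJac f).adjugate l j) := by
  simp [jacDer]

/-- `Δ` is the nonzero constant Jacobian determinant of the tuple `f`. -/
structure IsJacobian (ι : MvPolynomial (Fin m) K →ₐ[K] R) (f : Fin m → MvPolynomial (Fin m) K)
    (Δ : K) : Prop where
  ne : Δ ≠ 0
  det : ι (polyJac f).det = algebraMap K R Δ

namespace IsJacobian

variable {ι : MvPolynomial (Fin m) K →ₐ[K] R} {f : Fin m → MvPolynomial (Fin m) K} {Δ : K}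

/-- Multiplying the row `v` by `A` and then by `B` scales it by the unit `Δ`. The pair `A`, `B` will
be the Jacobian matrix and its adjugate, in either order and up to transposition. -/
theorem eq_zero_of_sum (hJ : IsJacobian ι f Δ) {A B : Matrix (Fin m) (Fin m) (MvPolynomial (Fin m) K)}
    (hAB : A * B = (polyJac f).det • 1) {v : Fin m → R}
    (hv : ∀ j, ∑ l, v l * ι (A l j) = 0) (i : Fin m) : v i = 0 := by
  have h : ∑ j, (∑ l, v l * ι (A l j)) * ι (B j i) = Δ • v i := by
    have h1 : ∀ l, ∑ j, v l * ι (A l j) * ι (B j i) = if l = i then Δ • v l else 0 := by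
      intro l
      simp_rw [mul_assoc, ← map_mul, ← Finset.mul_sum, ← map_sum, ← Matrix.mul_apply, hAB]
      rw [Matrix.smul_apply, Matrix.one_apply]
      split_ifs
      · rw [smul_eq_mul, mul_one, hJ.det, ← Algebra.commutes, ← Algebra.smul_def]
      · simp
    simp_rw [Finset.sum_mul]
    rw [Finset.sum_comm]
    simp [h1]
  simp only [hv, zero_mul, Finset.sum_const_zero] at h
  exact (smul_eq_zero.1 h.symm).resolve_left hJ.ne

/-- A derivation along the inclusion of the polynomials is determined by its values on a tuple with
invertible Jacobian determinant. -/
theorem derivation_eq_zero (hJ : IsJacobian ι f Δ) (hι : ∀ f a, ι f * a = a * ι f)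
    {E : MvPolynomial (Fin m) K →ₗ[K] R} (hE : ∀ f g, E (f * g) = E f * ι g + ι f * E g)
    (hf : ∀ k, E (f k) = 0) (g : MvPolynomial (Fin m) K) : E g = 0 := by
  have h1 : E 1 = 0 := by simpa using hE 1 1
  -- By the chain rule, vanishing on the `f k` is a linear system for the values on the variables,
  -- with the transposed Jacobian as matrix.
  have chain (g : MvPolynomial (Fin m) K) :
      E g = ∑ l, E (MvPolynomial.X l) * ι (MvPolynomial.pderiv l g) := by
    induction g using MvPolynomial.induction_on with
    | C r => simp [← MvPolynomial.algebraMap_eq, Algebra.algebraMap_eq_smul_one, h1]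
    | add g g' hg hg' => rw [map_add, hg, hg', ← Finset.sum_add_distrib]; simp [mul_add]
    | mul_X g k hg =>
      rw [hE, hg]
      simp only [Derivation.leibniz, smul_eq_mul, map_add, map_mul, mul_add,
        Finset.sum_add_distrib, MvPolynomial.pderiv_X, Finset.sum_mul]
      rw [add_comm]
      congr 1
      · rw [Finset.sum_eq_single k]
        · simp [hι]
        · intro l _ hl
          simp [Ne.symm hl]
        · simp
      · refine Finset.sum_congr rfl fun l _ => ?_
        rw [mul_assoc, ← map_mul, ← map_mul, mul_comm (MvPolynomial.pderiv l g)]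
  have hX := hJ.eq_zero_of_sum (A := (polyJac f).transpose) (B := (polyJac f).adjugate.transpose)
    (by rw [← Matrix.transpose_mul, Matrix.adjugate_mul, Matrix.transpose_smul,
      Matrix.transpose_one]) (v := fun l => E (MvPolynomial.X l)) fun k => by
      rw [← hf k, chain (f k)]
      rfl
  rw [chain]
  simp [hX]

variable {d : Fin m → R →ₗ[K] R} {x : Gen n m → R}

theorem eq_zero_of_jacDer (hJ : IsJacobian ι f Δ) {a : R} (ha : ∀ j, jacDer ι d f Δ j a = 0)
    (l : Fin m) : d l a = 0 := by
  refine hJ.eq_zero_of_sum (A := (polyJac f).adjugate) (B := polyJac f)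
    (Matrix.adjugate_mul _) (v := fun l => d l a) (fun j => ?_) l
  have := ha j
  rw [jacDer_apply] at this
  exact (smul_eq_zero.1 this).resolve_left (inv_ne_zero hJ.ne)

end IsJacobian

namespace IsModel

variable {ι : MvPolynomial (Fin m) K →ₐ[K] R} {f : Fin m → MvPolynomial (Fin m) K} {Δ : K}
  {d : Fin m → R →ₗ[K] R} {x : Gen n m → R}

theorem isDer_jacDer (h : IsModel x ι d) (j : Fin m) : IsDer (jacDer ι d f Δ j) := by
  intro a b
  simp only [jacDer_apply, smul_mul_assoc, mul_smul_comm, ← smul_add, Finset.sum_mul,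
    Finset.mul_sum, ← Finset.sum_add_distrib]
  congr 1
  refine Finset.sum_congr rfl fun l _ => ?_
  rw [h.isDer l a b, add_mul, mul_assoc, ← h.ι_comm _ b, ← mul_assoc, mul_assoc a]

theorem jacDer_ι (h : IsModel x ι d) (j : Fin m) (g : MvPolynomial (Fin m) K) :
    jacDer ι d f Δ j (ι g) =
      ι (Δ⁻¹ • ∑ l, MvPolynomial.pderiv l g * (polyJac f).adjugate l j) := by
  simp [jacDer_apply, h.d_ι]

theorem jacDer_inl (h : IsModel x ι d) (j : Fin m) (b : Fin n ⊕ Fin n) :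
    jacDer ι d f Δ j (x (Sum.inl b)) = 0 := by
  simp [jacDer_apply, h.d_inl]

theorem jacDer_tuple (h : IsModel x ι d) (hJ : IsJacobian ι f Δ) (j k : Fin m) :
    jacDer ι d f Δ j (ι (f k)) = if j = k then 1 else 0 := by
  have h1 : ∑ l, MvPolynomial.pderiv l (f k) * (polyJac f).adjugate l j =
      (polyJac f * (polyJac f).adjugate) k j := rfl
  rw [h.jacDer_ι, h1, Matrix.mul_adjugate, Matrix.smul_apply, Matrix.one_apply, map_smul]
  by_cases hjk : j = k
  · rw [if_pos hjk.symm, if_pos hjk, smul_eq_mul, mul_one, hJ.det, Algebra.algebraMap_eq_smul_one,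
      smul_smul, inv_mul_cancel₀ hJ.ne, one_smul]
  · rw [if_neg (Ne.symm hjk), if_neg hjk, smul_zero, map_zero, smul_zero]

/-- The commutator kills the Weyl generators. On $P_m$ it is a derivation that kills the tuple `f`,
whose first derivatives are 0 or 1, so it vanishes there too. -/
theorem jacDer_comm (h : IsModel x ι d) (hJ : IsJacobian ι f Δ) (i j : Fin m) (a : R) :
    jacDer ι d f Δ i (jacDer ι d f Δ j a) = jacDer ι d f Δ j (jacDer ι d f Δ i a) := by
  have hcom := (h.isDer_jacDer (f := f) (Δ := Δ) i).commutator (h.isDer_jacDer (f := f) (Δ := Δ) j)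
  refine sub_eq_zero.1 (hcom.eq_zero_of_adjoin h.adjoin ?_ a)
  rintro _ ⟨b | l, rfl⟩
  · simp [h.jacDer_inl]
  · rw [← h.ι_X]
    refine hJ.derivation_eq_zero h.ι_comm
      (E := (jacDer ι d f Δ i ∘ₗ jacDer ι d f Δ j - jacDer ι d f Δ j ∘ₗ jacDer ι d f Δ i) ∘ₗ
        ι.toLinearMap) (fun f g => ?_) (fun k => ?_) _
    · simpa using hcom (ι f) (ι g)
    · simp only [LinearMap.comp_apply, LinearMap.sub_apply, AlgHom.toLinearMap_apply,
        h.jacDer_tuple hJ]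
      split_ifs <;> simp [(h.isDer_jacDer _).map_one]

theorem weylDer_jacDer_comm (h : IsModel x ι d) (b : Fin n ⊕ Fin n)
    (j : Fin m) (a : R) : weylDer K (fun b => x (Sum.inl b)) b (jacDer ι d f Δ j a) =
      jacDer ι d f Δ j (weylDer K (fun b => x (Sum.inl b)) b a) := by
  have hcom := (isDer_weylDer (K := K) (fun b => x (Sum.inl b)) b).commutator
    (h.isDer_jacDer (f := f) (Δ := Δ) j)
  refine sub_eq_zero.1 (hcom.eq_zero_of_adjoin h.adjoin ?_ a)
  rintro _ ⟨c | l, rfl⟩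
  · have := h.weyl.weylDer_apply (K := K) b c
    simp only [LinearMap.sub_apply, LinearMap.comp_apply, h.jacDer_inl, this]
    split_ifs <;> simp [(h.isDer_jacDer _).map_one]
  · rw [← h.ι_X]
    simp only [LinearMap.sub_apply, LinearMap.comp_apply, h.jacDer_ι, h.weylDer_ι, map_zero,
      sub_zero]

/-- Constants for `u` lie in $P_m$, where the original Weyl derivations vanish; inverting the
Jacobian turns the remaining conditions into vanishing of all `d l`. -/
theorem exists_algebraMap_of_der_eq_zero [CharZero K] [Nontrivial R] (h : IsModel x ι d)
    (hJ : IsJacobian ι f Δ) {u : Fin n ⊕ Fin n → R} (hu : IsWeylFamily u) {a : R}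
    (hua : ∀ b, weylDer K u b a = 0) (hja : ∀ j, jacDer ι d f Δ j a = 0) :
    ∃ c : K, algebraMap K R c = a := by
  obtain ⟨g, rfl⟩ := h.mem_range_of_commute hu (commute_of_weylDer_eq_zero hua)
  refine h.isCoord.exists_algebraMap ?_
  rintro (b | l)
  · exact h.weylDer_ι _ b g
  · exact hJ.eq_zero_of_jacDer hja l

end IsModel

end Jacobian

/-! ### The endomorphisms $\sigma$ and $\tau$, and the subalgebra $B$. -/

section Endomorphism

variable {K R : Type*} [Field K] [Ring R] [Algebra K R] {n m : ℕ}

theorem IsModel.map_mem_of_gen {R' : Type*} [Ring R'] [Algebra K R'] {x : Gen n m → R}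
    {ι : MvPolynomial (Fin m) K →ₐ[K] R} {d : Fin m → R →ₗ[K] R} (h : IsModel x ι d)
    (τ : R →ₐ[K] R') {S : Subalgebra K R'} (hS : ∀ g, τ (x g) ∈ S) (a : R) : τ a ∈ S := by
  have : Algebra.adjoin K (Set.range x) ≤ S.comap τ :=
    Algebra.adjoin_le (by rintro _ ⟨g, rfl⟩; exact hS g)
  exact this (h.adjoin ▸ trivial)

/-- An endomorphism `σ` that maps the central variables to a tuple of polynomials `f` with constant
Jacobian determinant `Δ`, together with the endomorphism `τ` that agrees with `σ` on the Weyl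
algebra and fixes the central variables. -/
structure IsEndo (x : Gen n m → R) (ι : MvPolynomial (Fin m) K →ₐ[K] R) (d : Fin m → R →ₗ[K] R)
    (f : Fin m → MvPolynomial (Fin m) K) (Δ : K) (σ τ : R →ₐ[K] R) : Prop where
  model : IsModel x ι d
  jacobian : IsJacobian ι f Δ
  σ_inr : ∀ k, σ (x (Sum.inr k)) = ι (f k)
  τ_inl : ∀ b, τ (x (Sum.inl b)) = σ (x (Sum.inl b))
  τ_ι : ∀ g, τ (ι g) = ι g

namespace IsEndo

variable {x : Gen n m → R} {ι : MvPolynomial (Fin m) K →ₐ[K] R} {d : Fin m → R →ₗ[K] R}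
  {f : Fin m → MvPolynomial (Fin m) K} {Δ : K} {σ τ : R →ₐ[K] R}

theorem isWeylFamily (h : IsEndo x ι d f Δ σ τ) : IsWeylFamily fun b => σ (x (Sum.inl b)) :=
  h.model.weyl.map σ

theorem τ_weylDer (h : IsEndo x ι d f Δ σ τ) (b : Fin n ⊕ Fin n) (a : R) :
    τ (weylDer K (fun b => x (Sum.inl b)) b a) =
      weylDer K (fun b => σ (x (Sum.inl b))) b (τ a) := by
  rw [map_weylDer]
  congr 2
  funext b
  exact h.τ_inl b

theorem range_τ (h : IsEndo x ι d f Δ σ τ) : τ.range = σ.range ⊔ ι.range := by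
  apply le_antisymm
  · rintro _ ⟨a, rfl⟩
    refine h.model.map_mem_of_gen τ (fun g => ?_) a
    rcases g with b | l
    · rw [h.τ_inl]
      exact (le_sup_left : σ.range ≤ σ.range ⊔ ι.range) ⟨_, rfl⟩
    · rw [← h.model.ι_X, h.τ_ι]
      exact (le_sup_right : ι.range ≤ σ.range ⊔ ι.range) ⟨_, rfl⟩
  · refine sup_le ?_ ?_
    · rintro _ ⟨a, rfl⟩
      refine h.model.map_mem_of_gen σ (fun g => ?_) a
      rcases g with b | l
      · exact ⟨x (Sum.inl b), h.τ_inl b⟩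
      · exact ⟨ι (f l), by rw [h.σ_inr]; exact h.τ_ι _⟩
    · rintro _ ⟨g, rfl⟩
      exact ⟨ι g, h.τ_ι g⟩

variable [CharZero K]

/-- The kernel of `τ` is stable under the Weyl derivations, so if nonzero it would contain a nonzero
element of $P_m$, which `τ` fixes. -/
theorem τ_injective (h : IsEndo x ι d f Δ σ τ) : Function.Injective τ := by
  refine (injective_iff_map_eq_zero τ).2 fun a ha => by_contra fun ha0 => ?_
  have hc := h.model.isCoord
  obtain ⟨b, hb, hb0, hbD⟩ := exists_mem_ker_of_hasNilDegree
    (D := weylDer K fun b => x (Sum.inl b)) (h.model.weyl.weylDer_comm)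
    (fun b a => hc.nilpotent (Sum.inl b) a) (Q := fun a => τ a = 0) (fun b a k ha _ => by
      clear * - ha h
      induction k with
      | zero => exact ha
      | succ k ih => rw [pow_succ_apply, h.τ_weylDer, ih, map_zero]) ha ha0
  obtain ⟨g, rfl⟩ := h.model.mem_range_of_weylDer_eq_zero hbD
  exact hb0 ((h.τ_ι g).symm.trans hb)

/-- Taylor expansion in the `σ (x (Sum.inl b))` has coefficients in their centralizer, hence in
$P_m$. Conversely, each derivation kills $P_m$ and is nilpotent on these coordinates. -/
theorem mem_iff_nilpotent [Nontrivial R] (h : IsEndo x ι d f Δ σ τ) (a : R) :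
    (∀ b, ∃ k, (weylDer K (fun b => σ (x (Sum.inl b))) b ^ k) a = 0) ↔
      a ∈ σ.range ⊔ ι.range := by
  have hu := h.isWeylFamily
  constructor
  · intro ha
    refine mem_of_nilpotent (D := weylDer K fun b => σ (x (Sum.inl b)))
      (x := fun b => σ (x (Sum.inl b))) (T := ⊤) (fun b => isDer_weylDer _ b) hu.weylDer_comm
      hu.weylDer_apply (fun _ => trivial) (fun _ _ _ => trivial)
      (fun b => (le_sup_left : σ.range ≤ σ.range ⊔ ι.range) ⟨_, rfl⟩) (fun a _ hD => ?_) trivial ha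
    exact (le_sup_right : ι.range ≤ σ.range ⊔ ι.range)
      (h.model.mem_range_of_commute hu (commute_of_weylDer_eq_zero hD))
  · intro ha b
    rw [← h.range_τ] at ha
    obtain ⟨y, rfl⟩ := ha
    refine h.model.map_mem_of_gen τ (S := nilSubalgebra _ (isDer_weylDer _ b)) (fun g => ?_) y
    rcases g with c | l
    · refine ⟨2, ?_⟩
      rw [h.τ_inl, pow_succ_apply, pow_one, hu.weylDer_apply]
      split_ifs <;> simp [(isDer_weylDer _ _).map_one]
    · exact ⟨1, by rw [← h.model.ι_X, h.τ_ι, pow_one, h.model.weylDer_ι]⟩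

theorem forall_der_eq_zero_iff [Nontrivial R] (h : IsEndo x ι d f Δ σ τ) (a : R) :
    ((∀ b, weylDer K (fun b => σ (x (Sum.inl b))) b a = 0) ∧ ∀ j, jacDer ι d f Δ j a = 0) ↔
      a ∈ Set.range (algebraMap K R) := by
  constructor
  · rintro ⟨h1, h2⟩
    exact h.model.exists_algebraMap_of_der_eq_zero h.jacobian h.isWeylFamily h1 h2
  · rintro ⟨c, rfl⟩
    exact ⟨fun b => (isDer_weylDer _ b).map_algebraMap c,
      fun j => (h.model.isDer_jacDer j).map_algebraMap c⟩

/-- The inner derivations need not commute with `jacDer`, so the expansion has two stages: first in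
the Weyl coordinates over `T`, then in the `f j` for coefficients in $P_m$. The assumption `hnil` is
what puts the Weyl coordinates into `T` and makes `T` stable. -/
theorem nilpotent_iff [Nontrivial R] (h : IsEndo x ι d f Δ σ τ)
    (hnil : ∀ j b, ∃ k, (jacDer ι d f Δ j ^ k) (σ (x (Sum.inl b))) = 0) (a : R) :
    ((∀ b, ∃ k, (weylDer K (fun b => σ (x (Sum.inl b))) b ^ k) a = 0) ∧
      ∀ j, ∃ k, (jacDer ι d f Δ j ^ k) a = 0) ↔ a ∈ σ.range := by
  have hu := h.isWeylFamily
  have hj (j) : IsDer (jacDer ι d f Δ j) := h.model.isDer_jacDer j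
  constructor
  · rintro ⟨h1, h2⟩
    let T : Subalgebra K R := ⨅ j, nilSubalgebra _ (hj j)
    have hT {a : R} : a ∈ T ↔ ∀ j, ∃ k, (jacDer ι d f Δ j ^ k) a = 0 := Algebra.mem_iInf
    have hTu (b) : σ (x (Sum.inl b)) ∈ T := hT.2 fun j => hnil j b
    refine mem_of_nilpotent (D := weylDer K fun b => σ (x (Sum.inl b)))
      (x := fun b => σ (x (Sum.inl b))) (T := T) (S := σ.range) (fun b => isDer_weylDer _ b)
      hu.weylDer_comm hu.weylDer_apply hTu (fun b a ha => weylDer_mem hTu b ha)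
      (fun b => ⟨_, rfl⟩) (fun a ha hD => ?_) (hT.2 h2) h1
    refine mem_of_nilpotent (D := jacDer ι d f Δ) (x := fun j => ι (f j)) (T := ι.range)
      (S := σ.range) hj (h.model.jacDer_comm h.jacobian) (h.model.jacDer_tuple h.jacobian)
      (fun j => ⟨_, rfl⟩) (fun j a ha => ?_) (fun j => ⟨_, h.σ_inr j⟩) (fun a ha hD => ?_)
      (h.model.mem_range_of_commute hu (commute_of_weylDer_eq_zero hD)) (hT.1 ha)
    · obtain ⟨g, rfl⟩ := ha
      exact ⟨_, (h.model.jacDer_ι j g).symm⟩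
    · obtain ⟨g, rfl⟩ := ha
      obtain ⟨c, hc⟩ := (h.forall_der_eq_zero_iff (ι g)).1 ⟨fun b => h.model.weylDer_ι _ b g, hD⟩
      exact hc ▸ σ.range.algebraMap_mem c
  · intro ha
    refine ⟨(h.mem_iff_nilpotent a).2 ((le_sup_left : σ.range ≤ σ.range ⊔ ι.range) ha),
      fun j => ?_⟩
    obtain ⟨y, rfl⟩ := ha
    refine h.model.map_mem_of_gen σ (S := nilSubalgebra _ (hj j)) (fun g => ?_) y
    rcases g with b | l
    · exact hnil j b
    · refine ⟨2, ?_⟩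
      rw [h.σ_inr, pow_succ_apply, pow_one, h.model.jacDer_tuple h.jacobian]
      split_ifs <;> simp [(hj j).map_one]

/-- On elements of the form `τ y` the partial derivatives with respect to `σ(x)` are those with
respect to the generators of the Weyl algebra and the tuple `f`, transported by `τ`. -/
theorem mem_range_σ_of_nilpotent [Nontrivial R] (h : IsEndo x ι d f Δ σ τ) {y : R}
    (hy : ∀ j, ∃ k, (jacDer ι d f Δ j ^ k) y = 0) : τ y ∈ σ.range := by
  have hc := h.model.isCoord
  have hcomm := h.model.weylDer_jacDer_comm (f := f) (Δ := Δ)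
  let D : Gen n m → R →ₗ[K] R :=
    Sum.elim (weylDer K fun b => x (Sum.inl b)) (jacDer ι d f Δ)
  let z : Gen n m → R := Sum.elim (fun b => x (Sum.inl b)) fun j => ι (f j)
  -- Before `τ` is applied the two families do commute, so a single expansion in the original Weyl
  -- generators and the `f j` suffices; `τ` sends these coordinates to the `σ (x g)`.
  refine mem_of_nilpotent (D := D) (x := z) (T := ⊤) (S := σ.range.comap τ) ?_ ?_ ?_
    (fun _ => trivial) (fun _ _ _ => trivial) ?_ ?_ trivial ?_
  · rintro (b | j)
    · exact isDer_weylDer (K := K) (fun b => x (Sum.inl b)) b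
    · exact h.model.isDer_jacDer j
  · rintro (b | j) (c | k) a
    · exact h.model.weyl.weylDer_comm b c a
    · exact hcomm b k a
    · exact (hcomm c j a).symm
    · exact h.model.jacDer_comm h.jacobian j k a
  · rintro (b | j) (c | k)
    · simpa [D, z] using h.model.weyl.weylDer_apply (K := K) b c
    · simpa [D, z] using h.model.weylDer_ι _ b (f k)
    · simpa [D, z] using h.model.jacDer_inl j c
    · simpa [D, z] using h.model.jacDer_tuple h.jacobian j k
  · rintro (b | j)
    · exact ⟨_, (h.τ_inl b).symm⟩
    · exact ⟨_, (h.σ_inr j).trans (h.τ_ι _).symm⟩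
  · intro a _ ha
    obtain ⟨c, rfl⟩ := h.model.exists_algebraMap_of_der_eq_zero h.jacobian h.model.weyl
      (fun b => ha (Sum.inl b)) (fun j => ha (Sum.inr j))
    exact Subalgebra.algebraMap_mem _ c
  · rintro (b | j)
    · exact hc.nilpotent (Sum.inl b) y
    · exact hy j

/-- `jacDer` kills the original Weyl generators and is dual to `f`; conjugating it by the
isomorphism `τ` onto $B$ gives the required values on the `σ (x g)`. -/
theorem exists_derivations (h : IsEndo x ι d f Δ σ τ) {B : Subalgebra K R}
    (hB : B = σ.range ⊔ ι.range) :
    ∃ δ : Fin m → B →ₗ[K] B, (∀ j, IsDer (δ j)) ∧ ∀ j g, ∀ hg : σ (x g) ∈ B,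
      δ j ⟨σ (x g), hg⟩ = if g = Sum.inr j then 1 else 0 := by
  rw [← h.range_τ] at hB
  subst hB
  let e : R ≃ₐ[K] τ.range := AlgEquiv.ofInjective τ h.τ_injective
  have he (y : R) (hy : τ y ∈ τ.range) : (⟨τ y, hy⟩ : τ.range) = e y := rfl
  refine ⟨fun j => e.toLinearMap ∘ₗ jacDer ι d f Δ j ∘ₗ e.symm.toLinearMap, fun j a b => ?_,
    fun j g hg => ?_⟩
  · simp [h.model.isDer_jacDer j _ _]
  · rcases g with b | k
    · have : (⟨σ (x (Sum.inl b)), hg⟩ : τ.range) = e (x (Sum.inl b)) :=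
        Subtype.ext (h.τ_inl b).symm
      simp [this, h.model.jacDer_inl]
    · have : (⟨σ (x (Sum.inr k)), hg⟩ : τ.range) = e (ι (f k)) :=
        Subtype.ext ((h.σ_inr k).trans (h.τ_ι _).symm)
      simp only [this, LinearMap.comp_apply, AlgEquiv.toLinearMap_apply, AlgEquiv.symm_apply_apply,
        h.model.jacDer_tuple h.jacobian, Sum.inr.injEq, eq_comm (a := k)]
      split_ifs <;> simp

section Subalgebra

variable {D : Subalgebra K R} {δ : Fin m → D →ₗ[K] D}

-- Both sides are derivations from $P_m$ into `R` with the same values on the tuple `f`, which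
-- determines them.
omit [CharZero K] in
theorem derivation_apply_ι (h : IsEndo x ι d f Δ σ τ) (hD : ∀ g, ι g ∈ D)
    (hδ : ∀ j, IsDer (δ j)) (hx : ∀ j g, ∀ hg : σ (x g) ∈ D,
      δ j ⟨σ (x g), hg⟩ = if g = Sum.inr j then 1 else 0) (j : Fin m)
    (g : MvPolynomial (Fin m) K) : (δ j ⟨ι g, hD g⟩ : R) = jacDer ι d f Δ j (ι g) := by
  let ιD : MvPolynomial (Fin m) K →ₐ[K] D := ι.codRestrict D hD
  refine sub_eq_zero.1 (h.jacobian.derivation_eq_zero h.model.ι_comm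
    (E := D.val.toLinearMap ∘ₗ δ j ∘ₗ ιD.toLinearMap - jacDer ι d f Δ j ∘ₗ ι.toLinearMap)
    (fun g g' => ?_) (fun k => ?_) g)
  · have h1 : D.val (δ j (ιD g * ιD g')) =
        D.val (δ j (ιD g)) * ι g' + ι g * D.val (δ j (ιD g')) :=
      congrArg D.val (hδ j (ιD g) (ιD g'))
    have h2 := h.model.isDer_jacDer (f := f) (Δ := Δ) j (ι g) (ι g')
    simp only [LinearMap.sub_apply, LinearMap.comp_apply, AlgHom.toLinearMap_apply, map_mul, h1, h2]
    noncomm_ring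
  · have h1 : ιD (f k) = ⟨σ (x (Sum.inr k)), by rw [h.σ_inr]; exact hD _⟩ :=
      Subtype.ext (h.σ_inr k).symm
    simp only [LinearMap.sub_apply, LinearMap.comp_apply, AlgHom.toLinearMap_apply, h1, hx,
      h.model.jacDer_tuple h.jacobian, Sum.inr.injEq, eq_comm (a := k)]
    split_ifs <;> simp

-- Agreement is checked on generators: both sides vanish on the Weyl generators, and on the central
-- variables the formula on $P_m$ applies.
omit [CharZero K] in
theorem derivation_apply_τ (h : IsEndo x ι d f Δ σ τ) (hD : ∀ g, ι g ∈ D) (hτ : ∀ y, τ y ∈ D)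
    (hδ : ∀ j, IsDer (δ j)) (hx : ∀ j g, ∀ hg : σ (x g) ∈ D,
      δ j ⟨σ (x g), hg⟩ = if g = Sum.inr j then 1 else 0) (j : Fin m) (y : R) :
    δ j ⟨τ y, hτ y⟩ = ⟨τ (jacDer ι d f Δ j y), hτ _⟩ := by
  let τD : R →ₐ[K] D := τ.codRestrict D hτ
  have hder := h.model.isDer_jacDer (f := f) (Δ := Δ) j
  change δ j (τD y) = τD (jacDer ι d f Δ j y)
  have hy : y ∈ Algebra.adjoin K (Set.range x) := h.model.adjoin ▸ trivial
  induction hy using Algebra.adjoin_induction with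
  | mem y hy =>
    obtain ⟨b | l, rfl⟩ := hy
    · have h1 : τD (x (Sum.inl b)) = ⟨σ (x (Sum.inl b)), by rw [← h.τ_inl]; exact hτ _⟩ :=
        Subtype.ext (h.τ_inl b)
      rw [h1, hx, h.model.jacDer_inl, map_zero, if_neg Sum.inl_ne_inr]
    · rw [← h.model.ι_X]
      have h1 : τD (ι (MvPolynomial.X l)) = ⟨ι (MvPolynomial.X l), hD _⟩ := Subtype.ext (h.τ_ι _)
      rw [h1]
      refine Subtype.ext ((h.derivation_apply_ι hD hδ hx j _).trans ?_)
      rw [h.model.jacDer_ι]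
      exact (h.τ_ι _).symm
  | algebraMap r => rw [AlgHom.commutes, (hδ j).map_algebraMap, hder.map_algebraMap, map_zero]
  | add a b _ _ ha hb => simp only [map_add, ha, hb]
  | mul a b _ _ ha hb => rw [map_mul, hδ j, hder, ha, hb, map_add, map_mul, map_mul]

/-- The first condition forces `a = τ y`. There `δ j` corresponds to `jacDer` on `y`, and
injectivity of `τ` transfers nilpotency to `y`. -/
theorem nilpotent_subalgebra_iff [Nontrivial R] (h : IsEndo x ι d f Δ σ τ)
    (hBD : σ.range ⊔ ι.range ≤ D)
    (hδ : ∀ j, IsDer (δ j)) (hx : ∀ j g, ∀ hg : σ (x g) ∈ D,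
      δ j ⟨σ (x g), hg⟩ = if g = Sum.inr j then 1 else 0) (a : R) :
    ((∀ b, ∃ k, (weylDer K (fun b => σ (x (Sum.inl b))) b ^ k) a = 0) ∧
      ∃ ha : a ∈ D, ∀ j, ∃ k, (δ j ^ k) ⟨a, ha⟩ = 0) ↔ a ∈ σ.range := by
  have hD (g) : ι g ∈ D := hBD ((le_sup_right : ι.range ≤ σ.range ⊔ ι.range) ⟨g, rfl⟩)
  have hσ (y) : σ y ∈ D := hBD ((le_sup_left : σ.range ≤ σ.range ⊔ ι.range) ⟨y, rfl⟩)
  have hτ (y) : τ y ∈ D := hBD (h.range_τ ▸ ⟨y, rfl⟩)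
  constructor
  · rintro ⟨h1, ha, h2⟩
    have haB := (h.mem_iff_nilpotent a).1 h1
    rw [← h.range_τ] at haB
    obtain ⟨y, rfl⟩ := haB
    refine h.mem_range_σ_of_nilpotent fun j => ?_
    obtain ⟨k, hk⟩ := h2 j
    refine ⟨k, h.τ_injective ?_⟩
    have key (k : ℕ) : (δ j ^ k) ⟨τ y, ha⟩ = ⟨τ ((jacDer ι d f Δ j ^ k) y), hτ _⟩ := by
      induction k with
      | zero => rfl
      | succ k ih => simp only [pow_succ_apply, ih, h.derivation_apply_τ hD hτ hδ hx j]
    rw [map_zero]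
    exact congrArg Subtype.val ((key k).symm.trans hk)
  · rintro ⟨y, rfl⟩
    refine ⟨(h.mem_iff_nilpotent _).2 ((le_sup_left : σ.range ≤ σ.range ⊔ ι.range) ⟨y, rfl⟩),
      hσ y, fun j => ?_⟩
    refine h.model.map_mem_of_gen (σ.codRestrict D hσ) (S := nilSubalgebra _ (hδ j))
      (fun g => ⟨2, ?_⟩) y
    rw [pow_succ_apply, pow_one]
    have : (σ.codRestrict D hσ) (x g) = ⟨σ (x g), hσ _⟩ := rfl
    rw [this, hx]
    split_ifs <;> simp [(hδ j).map_one]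

theorem ker_subalgebra_iff [Nontrivial R] (h : IsEndo x ι d f Δ σ τ)
    (hBD : σ.range ⊔ ι.range ≤ D)
    (hδ : ∀ j, IsDer (δ j)) (hx : ∀ j g, ∀ hg : σ (x g) ∈ D,
      δ j ⟨σ (x g), hg⟩ = if g = Sum.inr j then 1 else 0) (a : R) :
    ((∀ b, weylDer K (fun b => σ (x (Sum.inl b))) b a = 0) ∧
      ∃ ha : a ∈ D, ∀ j, δ j ⟨a, ha⟩ = 0) ↔ a ∈ Set.range (algebraMap K R) := by
  have hD (g) : ι g ∈ D := hBD ((le_sup_right : ι.range ≤ σ.range ⊔ ι.range) ⟨g, rfl⟩)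
  constructor
  · rintro ⟨h1, ha, h2⟩
    refine (h.forall_der_eq_zero_iff a).1 ⟨h1, fun j => ?_⟩
    obtain ⟨g, rfl⟩ := h.model.mem_range_of_commute h.isWeylFamily (commute_of_weylDer_eq_zero h1)
    have := h.derivation_apply_ι hD hδ hx j g
    exact this.symm.trans (congrArg Subtype.val (h2 j))
  · rintro ⟨c, rfl⟩
    exact ⟨fun b => (isDer_weylDer _ b).map_algebraMap c, D.algebraMap_mem c,
      fun j => (hδ j).map_algebraMap c⟩

end Subalgebra

end IsEndo

end Endomorphism

/-! ### The concrete algebra $A_n\otimes P_m$ as an instance. -/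

section Canonical

variable (K : Type*) [Field K] (n m : ℕ)

/-- The inclusion `P_m → A_n ⊗ P_m`. -/
def pol : MvPolynomial (Fin m) K →ₐ[K] Alg K n m := Algebra.TensorProduct.includeRight

/-- The inclusion `A_n → A_n ⊗ P_m`. -/
def weylIncl : Weyl K n →ₐ[K] Alg K n m := Algebra.TensorProduct.includeLeft

variable {K n m}

theorem pol_apply (f : MvPolynomial (Fin m) K) : pol K n m f = 1 ⊗ₜ[K] f := rfl

theorem pol_comm (f : MvPolynomial (Fin m) K) (a : Alg K n m) :
    pol K n m f * a = a * pol K n m f := by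
  induction a using TensorProduct.induction_on with
  | zero => simp
  | tmul w g => simp [pol_apply, mul_comm]
  | add a b ha hb => rw [mul_add, add_mul, ha, hb]

theorem mkAlgHom_isWeylFamily :
    IsWeylFamily fun b => RingQuot.mkAlgHom K (WeylRel K n) (FreeAlgebra.ι K b) where
  pq i j := by
    have := RingQuot.mkAlgHom_rel K (WeylRel.pq (K := K) i j)
    simpa only [map_mul, map_add, apply_ite (RingQuot.mkAlgHom K (WeylRel K n)), map_one,
      map_zero] using this
  pp i j := by
    have := RingQuot.mkAlgHom_rel K (WeylRel.pp (K := K) i j)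
    simpa only [map_mul] using this
  qq i j := by
    have := RingQuot.mkAlgHom_rel K (WeylRel.qq (K := K) i j)
    simpa only [map_mul] using this

theorem isDer_centralPartial (l : Fin m) :
    IsDer (K := K) (R := Alg K n m) (centralPartial l) := by
  intro a b
  induction a using TensorProduct.induction_on with
  | zero => simp
  | add a a' ha ha' => rw [add_mul, map_add, map_add, ha, ha']; noncomm_ring
  | tmul w f =>
    induction b using TensorProduct.induction_on with
    | zero => simp
    | add a a' ha ha' => rw [mul_add, map_add, map_add, ha, ha']; noncomm_ring
    | tmul v g =>
      simp only [centralPartial, Algebra.TensorProduct.tmul_mul_tmul, LinearMap.lTensor_tmul,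
        Derivation.coeFn_coe, Derivation.leibniz, smul_eq_mul, ← TensorProduct.tmul_add]
      congr 1
      ring

theorem adjoin_range_gen : Algebra.adjoin K (Set.range (gen : Gen n m → Alg K n m)) = ⊤ := by
  set S := Algebra.adjoin K (Set.range (gen : Gen n m → Alg K n m)) with hS
  have hgen (g : Gen n m) : gen g ∈ S := Algebra.subset_adjoin ⟨g, rfl⟩
  have hw (w : Weyl K n) : weylIncl K n m w ∈ S := by
    obtain ⟨y, rfl⟩ := RingQuot.mkAlgHom_surjective K (WeylRel K n) w
    have hy : y ∈ Algebra.adjoin K (Set.range (FreeAlgebra.ι K : Fin n ⊕ Fin n → _)) := by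
      rw [FreeAlgebra.adjoin_range_ι]; trivial
    induction hy using Algebra.adjoin_induction with
    | mem y hy =>
      obtain ⟨b, rfl⟩ := hy
      exact hgen (Sum.inl b)
    | algebraMap r =>
      rw [AlgHom.commutes, AlgHom.commutes]
      exact S.algebraMap_mem r
    | add y z _ _ hy hz => rw [map_add, map_add]; exact S.add_mem hy hz
    | mul y z _ _ hy hz => rw [map_mul, map_mul]; exact S.mul_mem hy hz
  have hp (f : MvPolynomial (Fin m) K) : pol K n m f ∈ S := by
    induction f using MvPolynomial.induction_on with
    | C r => exact (pol K n m).commutes r ▸ S.algebraMap_mem r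
    | add f g hf hg => rw [map_add]; exact S.add_mem hf hg
    | mul_X f j hf => rw [map_mul]; exact S.mul_mem hf (hgen (Sum.inr j))
  refine eq_top_iff.2 fun a _ => ?_
  induction a using TensorProduct.induction_on with
  | zero => exact S.zero_mem
  | add a b ha hb => exact S.add_mem (ha trivial) (hb trivial)
  | tmul w f => simpa [pol, weylIncl] using S.mul_mem (hw w) (hp f)

theorem isModel_gen :
    IsModel (K := K) (R := Alg K n m) gen (pol K n m) (fun l => centralPartial l) where
  weyl := IsWeylFamily.map (R' := Alg K n m) mkAlgHom_isWeylFamily (weylIncl K n m)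
  ι_X _ := rfl
  ι_comm := pol_comm
  isDer := isDer_centralPartial
  d_ι _ _ := rfl
  d_inl l b := by simp [centralPartial, gen]
  adjoin := adjoin_range_gen

/-- The Weyl algebra acts on polynomials, $q_i$ by multiplication and $p_i$ by differentiation, and
the operator ring is nontrivial. -/
instance nontrivial_weyl : Nontrivial (Weyl K n) := by
  let M := MvPolynomial (Fin n) K
  let u : Fin n ⊕ Fin n → Module.End K M :=
    Sum.elim (fun i => LinearMap.mulLeft K (MvPolynomial.X i))
      fun i => (MvPolynomial.pderiv i).toLinearMap
  have hX (i j : Fin n) : MvPolynomial.pderiv (R := K) i (MvPolynomial.X j) =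
      if i = j then 1 else 0 := by
    rw [MvPolynomial.pderiv_X, Pi.single_apply]
    simp only [eq_comm]
  let ρ : Weyl K n →ₐ[K] Module.End K M := RingQuot.liftAlgHom K ⟨FreeAlgebra.lift K u, by
    rintro _ _ (⟨i, j⟩ | ⟨i, j⟩ | ⟨i, j⟩)
    · rw [map_mul, map_add, map_mul, FreeAlgebra.lift_ι_apply, FreeAlgebra.lift_ι_apply]
      refine LinearMap.ext fun f => ?_
      by_cases h : i = j <;> simp [u, hX, h]
    · rw [map_mul, map_mul, FreeAlgebra.lift_ι_apply, FreeAlgebra.lift_ι_apply]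
      have h : ⁅(MvPolynomial.pderiv i : Derivation K M M), MvPolynomial.pderiv j⁆ = 0 :=
        MvPolynomial.derivation_ext fun k => by
          rw [Derivation.commutator_apply, hX, hX]
          split_ifs <;> simp
      refine LinearMap.ext fun f => ?_
      have := congrArg (fun d : Derivation K M M => d f) h
      simpa [Derivation.commutator_apply, sub_eq_zero, u] using this
    · rw [map_mul, map_mul, FreeAlgebra.lift_ι_apply, FreeAlgebra.lift_ι_apply]
      refine LinearMap.ext fun f => ?_
      simp [u, mul_left_comm]⟩
  exact ρ.toRingHom.domain_nontrivial

instance nontrivial_alg : Nontrivial (Alg K n m) :=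
  inferInstance

/-- The endomorphism that agrees with `σ` on `A_n` and fixes `P_m`. -/
def fixCentral (σ : Alg K n m →ₐ[K] Alg K n m) : Alg K n m →ₐ[K] Alg K n m :=
  Algebra.TensorProduct.lift (σ.comp (weylIncl K n m)) (pol K n m) fun _ f => (pol_comm f _).symm

theorem isEndo_fixCentral (σ : Alg K n m →ₐ[K] Alg K n m)
    {f : Fin m → MvPolynomial (Fin m) K} (hf : ∀ k, σ (gen (Sum.inr k)) = pol K n m (f k))
    {Δ : K} (hJ : IsJacobian (R := Alg K n m) (pol K n m) f Δ) :
    IsEndo (K := K) (R := Alg K n m) gen (pol K n m) (fun l => centralPartial l) f Δ σ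
      (fixCentral σ) where
  model := isModel_gen
  jacobian := hJ
  σ_inr := hf
  τ_inl b := by simp [fixCentral, gen, weylIncl]
  τ_ι g := by simp [fixCentral, pol]

/-- A central variable commutes with the Weyl generators, so its image commutes with their images,
which again form a Weyl family. -/
theorem exists_pol_eq [CharZero K] (σ : Alg K n m →ₐ[K] Alg K n m) (k : Fin m) :
    ∃ f, σ (gen (Sum.inr k)) = pol K n m f := by
  have hu := IsWeylFamily.map (K := K) (R := Alg K n m) (R' := Alg K n m)
    (isModel_gen (K := K) (n := n) (m := m)).weyl σ
  obtain ⟨f, hf⟩ := (isModel_gen (K := K) (n := n) (m := m)).mem_range_of_commute hu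
    (c := σ (gen (Sum.inr k))) fun b =>
      (map_mul σ _ _).symm.trans
        ((congrArg σ (pol_comm (MvPolynomial.X k) _).symm).trans (map_mul σ _ _))
  exact ⟨f, hf.symm⟩

theorem jac_eq_map {σ : Alg K n m →ₐ[K] Alg K n m} {f : Fin m → MvPolynomial (Fin m) K}
    (hf : ∀ k, σ (gen (Sum.inr k)) = pol K n m (f k)) :
    jac σ = (polyJac f).map (pol K n m).toRingHom := by
  ext k l
  simp only [jac, Matrix.of_apply, hf]
  rfl

theorem partial'_inl (σ : Alg K n m →ₐ[K] Alg K n m) (Δ : K) (b : Fin n ⊕ Fin n) :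
    partial' σ Δ (Sum.inl b) = weylDer K (fun b => σ (gen (Sum.inl b))) b := by
  funext a
  rcases b with i | i
  · exact (ad_apply (K := K) (R := Alg K n m) _ a).symm
  · exact congrArg Neg.neg (ad_apply (K := K) (R := Alg K n m) _ a).symm

theorem partial'_inr {σ : Alg K n m →ₐ[K] Alg K n m} {f : Fin m → MvPolynomial (Fin m) K}
    (hf : ∀ k, σ (gen (Sum.inr k)) = pol K n m (f k)) (Δ : K) (j : Fin m) :
    partial' σ Δ (Sum.inr j) =
      jacDer (R := Alg K n m) (pol K n m) (fun l => centralPartial l) f Δ j := by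
  funext a
  have h1 := leibnizDet_updateRow (R := Alg K n m) (pol K n m).toRingHom pol_comm (polyJac f) j
    fun l => centralPartial l a
  rw [← jac_eq_map hf] at h1
  exact (congrArg (Δ⁻¹ • ·) h1).trans (jacDer_apply (R := Alg K n m) _ _ f Δ j a).symm

end Canonical

end WeylPoly

end

theorem proposition5p9 {K : Type*} [Field K] [CharZero K] (n m : ℕ)
    (σ : WeylPoly.Alg K n m →ₐ[K] WeylPoly.Alg K n m)
    (Δ : K) (hΔ : Δ ≠ 0)
    (hσ : WeylPoly.leibnizDet (WeylPoly.jac σ) = algebraMap K (WeylPoly.Alg K n m) Δ) :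
    -- the operators `∂'_1, …, ∂'_s` on `A`
    (⋂ g, {a | WeylPoly.partial' σ Δ g a = 0}) =
        Set.range (algebraMap K (WeylPoly.Alg K n m)) ∧
    ((⋂ g, WeylPoly.nilPart (WeylPoly.partial' σ Δ g)) = (σ.range : Set (WeylPoly.Alg K n m)) ↔
      ∀ (j : Fin m) (b : Fin n ⊕ Fin n), σ (WeylPoly.gen (Sum.inl b)) ∈
        WeylPoly.nilPart (WeylPoly.partial' σ Δ (Sum.inr j))) ∧
    -- the partial derivatives with respect to `σ(x_1), …, σ(x_s)`
    (⋂ b, WeylPoly.nilPart (WeylPoly.partial' σ Δ (Sum.inl b))) =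
        (WeylPoly.imagePoly σ : Set (WeylPoly.Alg K n m)) ∧
    (∃ δ : Fin m → WeylPoly.imagePoly σ →ₗ[K] WeylPoly.imagePoly σ,
        WeylPoly.IsCentralPartials σ (WeylPoly.imagePoly σ) δ) ∧
    ∀ D : Subalgebra K (WeylPoly.Alg K n m), WeylPoly.imagePoly σ ≤ D →
      ∀ δ : Fin m → D →ₗ[K] D, WeylPoly.IsCentralPartials σ D δ →
        (∀ j, ∀ f : D, (f : WeylPoly.Alg K n m) ∈ WeylPoly.polyPart K n m →
          (δ j f : WeylPoly.Alg K n m) = WeylPoly.partial' σ Δ (Sum.inr j) f) ∧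
        {a | (∀ b, a ∈ WeylPoly.nilPart (WeylPoly.partial' σ Δ (Sum.inl b))) ∧
            ∃ h : a ∈ D, ∀ j, ⟨a, h⟩ ∈ WeylPoly.nilPart (δ j)} =
          (σ.range : Set (WeylPoly.Alg K n m)) ∧
        {a | (∀ b, WeylPoly.partial' σ Δ (Sum.inl b) a = 0) ∧
            ∃ h : a ∈ D, ∀ j, δ j ⟨a, h⟩ = 0} =
          Set.range (algebraMap K (WeylPoly.Alg K n m)) := by
  -- From here on the Jacobian matrix has commuting polynomial entries, so `hσ` is a statement about
  -- an ordinary determinant.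
  choose f hf using WeylPoly.exists_pol_eq σ
  have hJ : WeylPoly.IsJacobian (R := WeylPoly.Alg K n m) (WeylPoly.pol K n m) f Δ :=
    ⟨hΔ, by rw [← hσ, WeylPoly.jac_eq_map hf, WeylPoly.leibnizDet_map]; rfl⟩
  have h := WeylPoly.isEndo_fixCentral σ hf hJ
  have hinl (b a) : a ∈ WeylPoly.nilPart (WeylPoly.partial' σ Δ (Sum.inl b)) ↔
      ∃ k, (WeylPoly.weylDer K (fun b => σ (WeylPoly.gen (Sum.inl b))) b ^ k) a = 0 := by
    rw [WeylPoly.partial'_inl]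
    exact WeylPoly.mem_nilPart_iff
  have hinr (j a) : a ∈ WeylPoly.nilPart (WeylPoly.partial' σ Δ (Sum.inr j)) ↔
      ∃ k, (WeylPoly.jacDer (R := WeylPoly.Alg K n m) (WeylPoly.pol K n m)
        (fun l => WeylPoly.centralPartial l) f Δ j ^ k) a = 0 := by
    rw [WeylPoly.partial'_inr hf]
    exact WeylPoly.mem_nilPart_iff
  refine ⟨?_, ⟨fun heq j b => ?_, fun hnil => ?_⟩, ?_, ?_, fun D hD δ hδ => ⟨fun j a ha => ?_, ?_, ?_⟩⟩
  · ext a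
    rw [← h.forall_der_eq_zero_iff a]
    simp only [Set.mem_iInter, Set.mem_ofPred_eq, Sum.forall, WeylPoly.partial'_inl,
      WeylPoly.partial'_inr hf]
  · have hb : σ (WeylPoly.gen (Sum.inl b)) ∈ (σ.range : Set (WeylPoly.Alg K n m)) := ⟨_, rfl⟩
    rw [← heq] at hb
    exact Set.mem_iInter.1 hb (Sum.inr j)
  · ext a
    rw [SetLike.mem_coe, ← h.nilpotent_iff (fun j b => (hinr j _).1 (hnil j b)) a]
    simp only [Set.mem_iInter, Sum.forall (p := fun g => a ∈ WeylPoly.nilPart _), hinl, hinr]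
  · ext a
    rw [SetLike.mem_coe, Set.mem_iInter]
    simp only [hinl]
    exact h.mem_iff_nilpotent a
  · obtain ⟨δ, h1, h2⟩ := h.exists_derivations (B := WeylPoly.imagePoly σ) rfl
    exact ⟨δ, h1, h2⟩
  · obtain ⟨a, haD⟩ := a
    obtain ⟨g, rfl⟩ := ha
    rw [WeylPoly.partial'_inr hf]
    exact h.derivation_apply_ι (fun g => hD ((le_sup_right :
      WeylPoly.polyPart K n m ≤ WeylPoly.imagePoly σ) ⟨g, rfl⟩)) hδ.1 hδ.2 j g
  · ext a
    rw [SetLike.mem_coe, ← h.nilpotent_subalgebra_iff hD hδ.1 hδ.2 a]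
    have hnil (j) (y : D) : y ∈ WeylPoly.nilPart (δ j) ↔ ∃ k, (δ j ^ k) y = 0 := by
      simp only [WeylPoly.nilPart, Set.mem_ofPred_eq, Module.End.pow_apply]
    simp only [Set.mem_ofPred_eq, hinl, hnil]
  · ext a
    rw [← h.ker_subalgebra_iff hD hδ.1 hδ.2 a]
    simp only [Set.mem_ofPred_eq, WeylPoly.partial'_inl]
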